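/- Let $A$ be a (not necessarily unital) $C^*$-algebra and let $\varphi$ be a faithful state on $A$ with GNS triple $(\mathcal H_\varphi,\pi_\varphi,\Omega_\varphi)$ whose Hilbert space $\mathcal H_\varphi$ is separable (this is automatic if $A$ is separable). Suppose that $\varphi$ satisfies the KMS condition at some $\beta\in\mathbb R$ for some one-parameter group $(\alpha_t)_{t\in\mathbb R}$ of $*$-automorphisms of $A$: for all $a,b\in A$ there is a bounded continuous function $F$ on the closed strip between $\operatorname{Im}z=0$ and $\operatorname{Im}z=\beta$, holomorphic in the interior of the strip, such that $F(t)=\varphi(a\,\alpha_t(b))$ and $F(t+i\beta)=\varphi(\alpha_t(b)\,a)$ for all $t\in\mathbb R$. Then all of the following conditions hold. (i) $\mathcal H_\varphi$ is separable and $\Omega_\varphi$ is separating for $\pi_\varphi(A)''$. (ii) There are a representation $\rho$ of $A$ on a separable Hilbert space $\mathcal H$ and a faithful normal state $\sigma$ on $B(\mathcal H)$ such that $\varphi=\sigma\circ\rho$. (iii) For every type III factor $M$ with separable predual and all normal states $\varphi_1,\dots,\varphi_n$ on $M$, there is an injective $*$-homomorphism $\gamma:A\to M$ with $\varphi_j\circ\gamma=\varphi$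 for all $j=1,\dots,n$. -/

import Mathlib

open scoped ComplexOrder InnerProductSpace Topology

universe u v

noncomputable section

/-- A positive linear functional is a state if its norm, that is the supremum of `‖φ a‖` over the
closed unit ball, equals `1`. (If the algebra has a unit, this amounts to `φ 1 = 1`.) -/
def IsState {B : Type u} [NonUnitalNormedRing B] [Module ℂ B] [PartialOrder B]
    (φ : B →ₚ[ℂ] ℂ) : Prop :=
  IsLUB ((fun a : B => ‖φ a‖) '' Metric.closedBall 0 1) 1

/-- A positive linear functional is faithful if `φ (a* a) = 0` only for `a = 0`. -/
def IsFaithful {B : Type u} [NonUnitalNormedRing B] [StarRing B] [Module ℂ B] [PartialOrder B]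
    (φ : B →ₚ[ℂ] ℂ) : Prop :=
  ∀ a : B, φ (star a * a) = 0 → a = 0

/-- A one-parameter group of `*`-automorphisms. No continuity in `t` is required. -/
structure IsOneParameterGroup {A : Type u} [NonUnitalCStarAlgebra A]
    (α : ℝ → (A ≃⋆ₐ[ℂ] A)) : Prop where
  map_zero : ∀ a, α 0 a = a
  map_add : ∀ s t a, α (s + t) a = α s (α t a)

/-- The Kubo-Martin-Schwinger condition at inverse temperature `β` (of any sign): for all `a, b`
there is a bounded continuous function on the closed strip between `Im z = 0` and `Im z = β`,
holomorphic in its interior, with boundary values `φ (a α_t(b))` at `t` and `φ (α_t(b) a)` at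
`t + i β`. -/
def IsKMS {A : Type u} [NonUnitalCStarAlgebra A] [PartialOrder A]
    (φ : A →ₚ[ℂ] ℂ) (α : ℝ → (A ≃⋆ₐ[ℂ] A)) (β : ℝ) : Prop :=
  ∀ a b : A, ∃ F : ℂ → ℂ,
    ContinuousOn F {z | min 0 β ≤ z.im ∧ z.im ≤ max 0 β} ∧
    (∃ C : ℝ, ∀ z : ℂ, min 0 β ≤ z.im → z.im ≤ max 0 β → ‖F z‖ ≤ C) ∧
    DifferentiableOn ℂ F {z | min 0 β < z.im ∧ z.im < max 0 β} ∧
    (∀ t : ℝ, F t = φ (a * α t b)) ∧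
    (∀ t : ℝ, F (t + β * Complex.I) = φ (α t b * a))

section Operators

variable {H : Type v} [NormedAddCommGroup H] [InnerProductSpace ℂ H] [CompleteSpace H]

variable (H) in
/-- The `σ`-weak (ultraweak) topology on `B(H)`: the coarsest topology for which
`x ↦ ∑ ⟪ξ n, x (η n)⟫` is continuous for all sequences `ξ, η` in `H` with
`∑ ‖ξ n‖² < ∞` and `∑ ‖η n‖² < ∞` (the series then converges absolutely). -/
abbrev sigmaWeakTopology : TopologicalSpace (H →L[ℂ] H) :=
  ⨅ (ξ : ℕ → H) (η : ℕ → H) (_ : Summable fun n => ‖ξ n‖ ^ 2) (_ : Summable fun n => ‖η n‖ ^ 2),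
    TopologicalSpace.induced (fun x : H →L[ℂ] H => ∑' n, ⟪ξ n, x (η n)⟫_ℂ) inferInstance

/-- Normality of a functional on `B(H)`: `σ`-weak continuity. -/
def IsNormalOnBH (f : (H →L[ℂ] H) → ℂ) : Prop :=
  Continuous[sigmaWeakTopology H, inferInstance] f

/-- `Ω` is separating for a set `S` of operators. -/
def IsSeparatingFor (S : Set (H →L[ℂ] H)) (Ω : H) : Prop :=
  ∀ x ∈ S, x Ω = 0 → x = 0

namespace VonNeumannAlgebra

/-- Normality of a functional on a von Neumann algebra: continuity for the relative `σ`-weak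
topology. -/
def IsNormal (M : VonNeumannAlgebra H) (f : M.toStarSubalgebra → ℂ) : Prop :=
  Continuous[TopologicalSpace.induced Subtype.val (sigmaWeakTopology H), inferInstance] f

/-- The predual: the space of all normal functionals, inside the normed dual space. -/
def predual (M : VonNeumannAlgebra H) : Set (StrongDual ℂ M.toStarSubalgebra) :=
  {f | M.IsNormal f}

/-- The predual is separable in the norm topology. -/
def HasSeparablePredual (M : VonNeumannAlgebra H) : Prop :=
  TopologicalSpace.IsSeparable M.predual

/-- A factor: a nonzero von Neumann algebra with trivial centre. -/
def IsFactor (M : VonNeumannAlgebra H) : Prop :=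
  Nontrivial H ∧ ∀ x ∈ M, x ∈ M.commutant → ∃ c : ℂ, x = c • (1 : H →L[ℂ] H)

/-- A projection `p` of `M` is finite if it is not Murray-von Neumann equivalent in `M` to a
proper subprojection of itself. -/
def IsFiniteProjection (M : VonNeumannAlgebra H) (p : H →L[ℂ] H) : Prop :=
  ∀ w ∈ M, star w * w = p → w * star w ≤ p → w * star w = p

/-- A factor is of type III if it has no nonzero finite projection. -/
def IsTypeIIIFactor (M : VonNeumannAlgebra H) : Prop :=
  M.IsFactor ∧ ∀ p ∈ M, IsStarProjection p → M.IsFiniteProjection p → p = 0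

end VonNeumannAlgebra

end Operators

section Conditions

variable {A : Type u} [NonUnitalCStarAlgebra A] [PartialOrder A] [StarOrderedRing A]

/-- `(H, π, Ω)` is a GNS triple of `φ`: the vector `Ω` is cyclic for the representation `π` and
implements `φ`. -/
structure IsGNSTriple (φ : A →ₚ[ℂ] ℂ) {H : Type v} [NormedAddCommGroup H]
    [InnerProductSpace ℂ H] [CompleteSpace H] (π : A →⋆ₙₐ[ℂ] (H →L[ℂ] H)) (Ω : H) : Prop where
  cyclic : Dense (Set.range fun a => π a Ω)
  inner_eq : ∀ a, ⟪Ω, π a Ω⟫_ℂ = φ a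

/-- The GNS space is separable, and the GNS vector is separating for the bicommutant of the
image of the GNS representation. The GNS space and the GNS representation are those of Mathlib;
the GNS vector is pinned, up to a unitary in the commutant of the representation, by
`IsGNSTriple`. -/
def GNSVectorSeparating (φ : A →ₚ[ℂ] ℂ) : Prop :=
  TopologicalSpace.SeparableSpace φ.GNS ∧
  ∃ Ω : φ.GNS, IsGNSTriple φ φ.gnsNonUnitalStarAlgHom Ω ∧
    IsSeparatingFor
      (Set.centralizer (Set.centralizer (Set.range φ.gnsNonUnitalStarAlgHom))) Ω

/-- `φ` is the pull-back of a faithful normal state of `B(H)`, for some separable `H`, along a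
representation on `H`. -/
def IsPullbackOfFaithfulNormalState (φ : A →ₚ[ℂ] ℂ) : Prop :=
  ∃ (H : Type u) (_ : NormedAddCommGroup H) (_ : InnerProductSpace ℂ H) (_ : CompleteSpace H)
    (_ : TopologicalSpace.SeparableSpace H)
    (ρ : A →⋆ₙₐ[ℂ] (H →L[ℂ] H)) (σ : (H →L[ℂ] H) →ₚ[ℂ] ℂ),
    IsState σ ∧ IsFaithful σ ∧ IsNormalOnBH σ ∧ ∀ a, φ a = σ (ρ a)

/-- For every type III factor `M` with separable predual (on a Hilbert space in an arbitrary
universe `v`) and finitely many normal states of `M`, there is an injective `*`-homomorphism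
`A → M` which pulls all of these states back to `φ`. -/
def EmbedsInTypeIIIFactors (φ : A →ₚ[ℂ] ℂ) : Prop :=
  ∀ (K : Type v) [NormedAddCommGroup K] [InnerProductSpace ℂ K] [CompleteSpace K]
    (M : VonNeumannAlgebra K), M.IsTypeIIIFactor → M.HasSeparablePredual →
    ∀ (n : ℕ) (ψ : Fin n → (M.toStarSubalgebra →ₚ[ℂ] ℂ)),
      (∀ j, IsState (ψ j)) → (∀ j, M.IsNormal (ψ j)) →
      ∃ γ : A →⋆ₙₐ[ℂ] M.toStarSubalgebra,
        Function.Injective γ ∧ ∀ j a, ψ j (γ a) = φ a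

end Conditions

end

/-! Everything rests on the GNS vector `Ω` being separating for `π(A)''`. Let `x` in the bicommutant
kill `Ω`. By density of `A` there are `a_n` with `π(a_n)Ω → 0` and `π(a_n)*η → x*η`, where `η =
π(c)*Ω`. The KMS functions of the pairs `(c a_n, b)` tend to zero uniformly on `Im z = β` and are
uniformly Cauchy on the real line. The three lines theorem carries the vanishing to the real line
(`IsStripFunction.norm_apply_zero_le`). At `0` this reads `⟨x*η, π(b)Ω⟩ = 0` for all `b` and `c`, so
`x = 0`.

A separating vector is cyclic for the commutant. With `Y_k` in `π(A)'`, `∑ Y_k* Y_k = 1` and `ζ_k =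
Y_k Ω` total, one gets `φ(a) = ∑ ⟨ζ_k, π(a) ζ_k⟩`. The functional `x ↦ ∑ ⟨ζ_k, x ζ_k⟩` on `B(H)` is
normal, and it is faithful by totality; this is (ii). Diagonalizing its density operator gives an
orthonormal basis `b_i` and weights `w_i > 0` of sum `1` with `φ(a) = ∑ w_i ⟨b_i, π(a) b_i⟩`.

For (iii) it suffices to find isometries `v_i` in `M` with orthogonal ranges such that `ψ_j(v_i
v_l*) = δ_il w_i` for all given states `ψ_j`. Then `γ(x) = ∑ ⟨b_i, x b_l⟩ v_i v_l*` satisfies `ψ_j ∘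
γ ∘ π = φ`, and faithfulness of `φ` makes `γ ∘ π` injective. The `v_i` are built inductively from
two facts about `M`. All nonzero projections are equivalent to `1`
(`IsTypeIIIFactor.exists_isometry`), which supplies the isometries. Lyapunov's theorem
(`IsTypeIIIFactor.exists_projection_apply_eq`) supplies projections on which all `ψ_j` take a
prescribed common value, and symmetries that annihilate the off-diagonal values. -/

set_option linter.unusedSectionVars false

open Filter

/-! ### Convergence in the weak operator topology -/

section WeakOperatorConvergence

variable {K : Type*} [NormedAddCommGroup K] [InnerProductSpace ℂ K] [CompleteSpace K]
  {ι : Type*}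

/-- Convergence of operators along a filter in the weak operator topology. -/
def WeakTendsto (f : ι → K →L[ℂ] K) (l : Filter ι) (x : K →L[ℂ] K) : Prop :=
  ∀ ξ η, Tendsto (fun i => ⟪ξ, f i η⟫_ℂ) l (𝓝 ⟪ξ, x η⟫_ℂ)

namespace WeakTendsto

variable {f : ι → K →L[ℂ] K} {l : Filter ι} {x y : K →L[ℂ] K}

theorem const (x : K →L[ℂ] K) (l : Filter ι) : WeakTendsto (fun _ => x) l x :=
  fun _ _ => tendsto_const_nhds

theorem mul_mul (h : WeakTendsto f l x) (a b : K →L[ℂ] K) :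
    WeakTendsto (fun i => a * f i * b) l (a * x * b) := by
  intro ξ η
  have := h (star a ξ) (b η)
  simpa [ContinuousLinearMap.star_eq_adjoint, ContinuousLinearMap.adjoint_inner_left] using this

theorem mul_left (h : WeakTendsto f l x) (a : K →L[ℂ] K) :
    WeakTendsto (fun i => a * f i) l (a * x) := by
  simpa using h.mul_mul a 1

theorem mul_right (h : WeakTendsto f l x) (b : K →L[ℂ] K) :
    WeakTendsto (fun i => f i * b) l (x * b) := by
  simpa using h.mul_mul 1 b

theorem congr' {g : ι → K →L[ℂ] K} (h : WeakTendsto f l x) (hfg : f =ᶠ[l] g) :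
    WeakTendsto g l x := fun ξ η =>
  (h ξ η).congr' (hfg.mono fun i hi => by simp only [hi])

theorem unique [l.NeBot] (h : WeakTendsto f l x) (h' : WeakTendsto f l y) : x = y := by
  ext η
  exact ext_inner_left ℂ fun ξ => tendsto_nhds_unique (h ξ η) (h' ξ η)

/-- Multiplication by a fixed operator is weakly continuous, so commutation with the commutant
survives in the limit; the bicommutant theorem does the rest. -/
theorem mem [l.NeBot] {M : VonNeumannAlgebra K} (h : WeakTendsto f l x)
    (hf : ∀ᶠ i in l, f i ∈ M) : x ∈ M := by
  rw [← M.commutant_commutant, VonNeumannAlgebra.mem_commutant_iff]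
  intro g hg
  refine (h.mul_left g).unique ((h.mul_right g).congr' (hf.mono fun i hi => ?_))
  exact (VonNeumannAlgebra.mem_commutant_iff.1 hg _ hi)

end WeakTendsto

/-- The closed balls of `B(K)` are compact in the weak operator topology. -/
theorem exists_weakTendsto_of_ultrafilter (U : Ultrafilter ι) (f : ι → K →L[ℂ] K) {R : ℝ}
    (hR : 0 ≤ R) (hf : ∀ᶠ i in (U : Filter ι), ‖f i‖ ≤ R) :
    ∃ x : K →L[ℂ] K, ‖x‖ ≤ R ∧ WeakTendsto f U x := by
  -- Every bounded matrix coefficient converges along an ultrafilter. The limits form a bounded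
  -- sesquilinear form, hence come from an operator.
  have key : ∀ ξ η : K, ∃ c : ℂ, ‖c‖ ≤ R * ‖ξ‖ * ‖η‖ ∧
      Tendsto (fun i => ⟪ξ, f i η⟫_ℂ) U (𝓝 c) := by
    intro ξ η
    obtain ⟨c, hc, hc'⟩ := (isCompact_closedBall (0 : ℂ) (R * ‖ξ‖ * ‖η‖)).ultrafilter_le_nhds
      (U.map fun i => ⟪ξ, f i η⟫_ℂ) (by
        rw [le_principal_iff]
        refine hf.mono fun i hi => ?_
        rw [mem_closedBall_zero_iff]
        calc _ ≤ ‖ξ‖ * ‖f i η‖ := norm_inner_le_norm _ _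
          _ ≤ ‖ξ‖ * (R * ‖η‖) := by gcongr; exact (f i).le_of_opNorm_le hi η
          _ = _ := by ring)
    exact ⟨c, by simpa using hc, hc'⟩
  choose B hB hlim using key
  let B' : K →ₗ⋆[ℂ] K →ₗ[ℂ] ℂ := LinearMap.mk₂'ₛₗ (starRingEnd ℂ) (RingHom.id ℂ) B
    (fun a b c => tendsto_nhds_unique (hlim _ _)
      (((hlim a c).add (hlim b c)).congr fun i => by rw [inner_add_left]))
    (fun s a c => tendsto_nhds_unique (hlim _ _)
      (((hlim a c).const_smul (starRingEnd ℂ s)).congr fun i => by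
        rw [inner_smul_left, smul_eq_mul]))
    (fun a b c => tendsto_nhds_unique (hlim _ _)
      (((hlim a b).add (hlim a c)).congr fun i => by rw [map_add, inner_add_right]))
    (fun s a c => tendsto_nhds_unique (hlim _ _)
      (((hlim a c).const_smul s).congr fun i => by
        rw [map_smul, inner_smul_right, smul_eq_mul]))
  let B'' : K →L⋆[ℂ] K →L[ℂ] ℂ := B'.mkContinuous₂ R fun ξ η => hB ξ η
  have hx : ∀ ξ η, ⟪ξ, star (InnerProductSpace.continuousLinearMapOfBilin B'') η⟫_ℂ = B ξ η := by
    intro ξ η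
    rw [ContinuousLinearMap.star_eq_adjoint, ContinuousLinearMap.adjoint_inner_right,
      InnerProductSpace.continuousLinearMapOfBilin_apply]
    rfl
  refine ⟨_, ?_, fun ξ η => by rw [hx]; exact hlim ξ η⟩
  refine ContinuousLinearMap.opNorm_le_bound _ hR fun η => ?_
  set x := star (InnerProductSpace.continuousLinearMapOfBilin B'')
  rcases eq_or_ne (x η) 0 with h0 | h0
  · rw [h0, norm_zero]; positivity
  have h1 := hB (x η) η
  rw [← hx, inner_self_eq_norm_sq_to_K, norm_pow, RCLike.norm_ofReal, abs_norm] at h1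
  have : 0 < ‖x η‖ := norm_pos_iff.2 h0
  nlinarith

end WeakOperatorConvergence

/-! ### Projections and functional calculus in a von Neumann algebra -/

namespace VonNeumannAlgebra

variable {K : Type*} [NormedAddCommGroup K] [InnerProductSpace ℂ K] [CompleteSpace K]
  (M : VonNeumannAlgebra K)

theorem mem_iff_forall_commute {x : K →L[ℂ] K} :
    x ∈ M ↔ ∀ y ∈ M.commutant, Commute y x := by
  conv_lhs => rw [← M.commutant_commutant, mem_commutant_iff]
  rfl

variable {M}

theorem starProjection_mem (S : Submodule ℂ K) [S.HasOrthogonalProjection]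
    (h : ∀ y ∈ M.commutant, ∀ ξ ∈ S, y ξ ∈ S) : S.starProjection ∈ M := by
  rw [IsStarProjection.mem_iff isStarProjection_starProjection]
  intro y hy
  rw [Submodule.range_starProjection, Module.End.mem_invtSubmodule]
  exact h y hy

theorem smul_mem {x : K →L[ℂ] K} (hx : x ∈ M) (c : ℂ) : c • x ∈ M :=
  M.toStarSubalgebra.smul_mem hx c

theorem cfc_mem {h : K →L[ℂ] K} (hh : h ∈ M) (f : ℝ → ℝ) : cfc f h ∈ M := by
  rw [mem_iff_forall_commute] at hh ⊢
  exact fun y hy => ((hh y hy).symm.cfc_real f).symm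

/-- The projection onto the closure of the range of a nonzero element of the form `f h`, where `f`
vanishes on `[0, ‖h‖ / 2]`, together with a function of `h` inverting `h` there. -/
theorem exists_projection_inverting {h : K →L[ℂ] K} (hh : h ∈ M) (h0 : 0 ≤ h) (hne : h ≠ 0) :
    ∃ p ∈ M, IsStarProjection p ∧ p ≠ 0 ∧
      ∃ k ∈ M, IsSelfAdjoint k ∧ Commute k h ∧ k * h * k * p = p := by
  have hpos : 0 < ‖h‖ := norm_pos_iff.2 hne
  set ε := ‖h‖ / 2 with hε
  have hεpos : 0 < ε := by positivity
  have hsa : IsSelfAdjoint h := .of_nonneg h0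
  -- On the range of `c = (h - ε)₊` one has `h ≥ ε`, so `k = max(h, ε)^(-1/2)` inverts `h` there;
  -- the truncation keeps `k` continuous. Moreover `c ≠ 0`, because `‖h‖` lies in the spectrum and
  -- exceeds `ε`.
  set c := cfc (fun x : ℝ => max (x - ε) 0) h with hc
  set k := cfc (fun x : ℝ => (√(max x ε))⁻¹) h with hk
  have hkcont : Continuous (fun x : ℝ => (√(max x ε))⁻¹) := by
    refine Continuous.inv₀ (by fun_prop) fun x => ?_
    exact (Real.sqrt_pos.2 (lt_max_of_lt_right hεpos)).ne'
  have hcM : c ∈ M := cfc_mem hh _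
  have hkM : k ∈ M := cfc_mem hh _
  have hc0 : c ≠ 0 := by
    intro h00
    have : Nontrivial (K →L[ℂ] K) := ⟨h, 0, hne⟩
    have h1 : ‖h‖ ∈ spectrum ℝ h := CStarAlgebra.norm_mem_spectrum_of_nonneg h0
    have h2 := cfc_map_spectrum (R := ℝ) (fun x : ℝ => max (x - ε) 0) h
    rw [← hc, h00, spectrum.zero_eq] at h2
    have h3 : max (‖h‖ - ε) 0 ∈ ({0} : Set ℝ) := h2 ▸ Set.mem_image_of_mem _ h1
    have h4 : ‖h‖ - ε ≤ 0 := max_eq_right_iff.1 h3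
    linarith
  have hkhkc : k * h * k * c = c := by
    have hid : h = cfc (fun x : ℝ => x) h := (cfc_id' ℝ h).symm
    conv_lhs => rw [hid]
    have hk1 := hkcont.continuousOn (s := spectrum ℝ h)
    have hk2 : ContinuousOn (fun x : ℝ => (√(max x ε))⁻¹ * x) (spectrum ℝ h) :=
      hk1.mul continuousOn_id
    rw [hk, hc, ← cfc_mul _ _ h hk1 (continuousOn_id' _), ← cfc_mul _ _ h hk2 hk1,
      ← cfc_mul (fun x : ℝ => (√(max x ε))⁻¹ * x * (√(max x ε))⁻¹) _ h (hk2.mul hk1)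
        (by fun_prop)]
    refine cfc_congr fun x _ => ?_
    rcases le_total x ε with hx | hx
    · simp [max_eq_right (sub_nonpos.2 hx)]
    · have hx0 : 0 < x := hεpos.trans_le hx
      simp only [max_eq_left hx]
      have := Real.mul_self_sqrt hx0.le
      have h5 : (√x) ≠ 0 := (Real.sqrt_pos.2 hx0).ne'
      field_simp
      rw [sq, this]
  let S : Submodule ℂ K := (LinearMap.range (c : K →ₗ[ℂ] K)).topologicalClosure
  have hScl : IsClosed (S : Set K) := Submodule.isClosed_topologicalClosure _
  have : CompleteSpace S := hScl.completeSpace_coe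
  have hcS : ∀ ξ, c ξ ∈ S := fun ξ => Submodule.le_topologicalClosure _ ⟨ξ, rfl⟩
  refine ⟨S.starProjection, starProjection_mem S ?_, isStarProjection_starProjection, ?_,
    k, hkM, cfc_predicate _ _, ?_, ?_⟩
  · intro y hy ξ hξ
    have hyc : Commute y c := (mem_iff_forall_commute M).1 hcM y hy
    refine map_mem_closure y.continuous hξ ?_
    rintro _ ⟨ζ, rfl⟩
    exact ⟨y ζ, (DFunLike.congr_fun hyc.eq ζ).symm⟩
  · intro h00
    apply hc0
    ext ξ
    have := Submodule.starProjection_eq_self_iff.2 (hcS ξ)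
    rw [h00] at this
    simpa using this.symm
  · exact (Commute.refl h).cfc_real _
  · have hcl : ∀ ξ ∈ S, (k * h * k) ξ = ξ := by
      intro ξ hξ
      refine closure_minimal (s := Set.range c) (t := {ξ | (k * h * k) ξ = ξ}) ?_
        (isClosed_eq (by fun_prop) continuous_id) hξ
      rintro _ ⟨ζ, rfl⟩
      exact DFunLike.congr_fun hkhkc ζ
    ext ξ
    exact hcl _ (Submodule.starProjection_apply_mem S ξ)

end VonNeumannAlgebra

/-! ### Partial isometries -/

section PartialIsometry

variable {R : Type*} [NonUnitalNormedRing R] [StarRing R] [CStarRing R]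

theorem mul_eq_self_of_star_mul_self {u p : R} (hp : IsStarProjection p) (h : star u * u = p) :
    u * p = u := by
  have hp1 : p * p = p := hp.isIdempotentElem
  have hp2 : star p = p := hp.isSelfAdjoint
  have : star (u * p - u) * (u * p - u) = 0 := by
    have e : star (u * p - u) * (u * p - u) =
        star p * (star u * u) * p - star p * (star u * u) - (star u * u) * p + star u * u := by
      simp only [star_sub, star_mul]; noncomm_ring
    rw [e, h, hp2, hp1, hp1]; noncomm_ring
  exact sub_eq_zero.1 (CStarRing.star_mul_self_eq_zero_iff _ |>.1 this)

theorem isStarProjection_mul_star {u p : R} (hp : IsStarProjection p) (h : star u * u = p) :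
    IsStarProjection (u * star u) where
  isIdempotentElem := by
    have := mul_eq_self_of_star_mul_self hp h
    calc u * star u * (u * star u) = u * (star u * u) * star u := by noncomm_ring
      _ = _ := by rw [h, this]
  isSelfAdjoint := .mul_star_self u

end PartialIsometry

/-! ### Comparison in factors and countability of orthogonal families -/

namespace VonNeumannAlgebra

variable {K : Type*} [NormedAddCommGroup K] [InnerProductSpace ℂ K] [CompleteSpace K]
  {M : VonNeumannAlgebra K}

/-- The closed span of `M p K` is invariant under `M'` and under `M`, so its projection is central,
hence a scalar. The scalar is nonzero since `p ≠ 0`, and a `q` killing the whole span would vanish.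
-/
theorem IsFactor.exists_mul_mul_ne_zero (hM : M.IsFactor) {p q : K →L[ℂ] K} (hp : p ∈ M)
    (hp0 : p ≠ 0) (hq0 : q ≠ 0) : ∃ m ∈ M, q * m * p ≠ 0 := by
  by_contra! hcon
  let S : Submodule ℂ K :=
    (Submodule.span ℂ {ζ : K | ∃ m ∈ M, ∃ ξ, ζ = m (p ξ)}).topologicalClosure
  have hScl : IsClosed (S : Set K) := Submodule.isClosed_topologicalClosure _
  have : CompleteSpace S := hScl.completeSpace_coe
  have hmem : ∀ m ∈ M, ∀ ξ, m (p ξ) ∈ S := fun m hm ξ =>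
    Submodule.le_topologicalClosure _ (Submodule.subset_span ⟨m, hm, ξ, rfl⟩)
  have hind : ∀ y : K →L[ℂ] K, (∀ m ∈ M, ∀ ξ, y (m (p ξ)) ∈ S) → ∀ ξ ∈ S, y ξ ∈ S := by
    intro y hy ξ hξ
    have h1 : Submodule.span ℂ {ζ : K | ∃ m ∈ M, ∃ ξ, ζ = m (p ξ)} ≤
        S.comap (y : K →ₗ[ℂ] K) := by
      rw [Submodule.span_le]
      rintro _ ⟨m, hm, ζ, rfl⟩
      exact hy m hm ζ
    exact Submodule.topologicalClosure_minimal _ h1 (hScl.preimage y.continuous) hξ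
  have hP : S.starProjection ∈ M := starProjection_mem S fun y hy => hind y fun m hm ξ => by
    have h1 := DFunLike.congr_fun ((mem_iff_forall_commute M).1 (mul_mem hm hp) y hy).eq ξ
    have h2 : y (m (p ξ)) = m (p (y ξ)) := h1
    rw [h2]
    exact hmem m hm _
  have hP' : S.starProjection ∈ M.commutant := starProjection_mem S fun y hy =>
    hind y fun m hm ξ => by
      rw [commutant_commutant] at hy
      exact hmem (y * m) (mul_mem hy hm) ξ
  obtain ⟨c, hc⟩ := hM.2 _ hP hP'
  have hPp : S.starProjection * p = p := by
    ext ξ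
    exact Submodule.starProjection_eq_self_iff.2 (hmem 1 (one_mem M) ξ)
  have hqS : ∀ ξ ∈ S, q ξ = 0 := by
    intro ξ hξ
    have h1 : Submodule.span ℂ {ζ : K | ∃ m ∈ M, ∃ ξ, ζ = m (p ξ)} ≤
        LinearMap.ker (q : K →ₗ[ℂ] K) := by
      rw [Submodule.span_le]
      rintro _ ⟨m, hm, ζ, rfl⟩
      exact DFunLike.congr_fun (hcon m hm) ζ
    exact Submodule.topologicalClosure_minimal _ h1
      (isClosed_eq q.continuous continuous_const) hξ
  have hqP : q * S.starProjection = 0 := by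
    ext ξ
    exact hqS _ (Submodule.starProjection_apply_mem S ξ)
  rw [hc, smul_mul_assoc, one_mul] at hPp
  have hc0 : c ≠ 0 := by
    rintro rfl
    exact hp0 (by rw [← hPp, zero_smul])
  rw [hc, mul_smul_comm, mul_one] at hqP
  exact (smul_ne_zero hc0 hq0) hqP

/-- A truncated polar decomposition: for `a = q m p ≠ 0` let `r` be a spectral projection of `a* a`
away from zero and `k` an inverse square root there. Then `u = a k r` has `u* u = r k a* a k r = r`.
-/
theorem IsFactor.exists_partialIsometry (hM : M.IsFactor) {p q : K →L[ℂ] K}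
    (hp : p ∈ M) (hpp : IsStarProjection p) (hq : q ∈ M) (hqq : IsStarProjection q)
    (hp0 : p ≠ 0) (hq0 : q ≠ 0) :
    ∃ u ∈ M, u ≠ 0 ∧ IsStarProjection (star u * u) ∧ u * p = u ∧ q * u = u := by
  obtain ⟨m, hm, hne⟩ := hM.exists_mul_mul_ne_zero hp hp0 hq0
  have hp1 : p * p = p := hpp.isIdempotentElem
  have hp2 : star p = p := hpp.isSelfAdjoint
  have hq1 : q * q = q := hqq.isIdempotentElem
  set a := q * m * p
  have ha : a ∈ M := mul_mem (mul_mem hq hm) hp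
  obtain ⟨r, hr, hrr, hr0, k, hk, hks, hkc, hkr⟩ :=
    exists_projection_inverting (mul_mem (star_mem ha) ha) (star_mul_self_nonneg a)
      (fun h => hne ((CStarRing.star_mul_self_eq_zero_iff _).1 h))
  have hr1 : r * r = r := hrr.isIdempotentElem
  have hr2 : star r = r := hrr.isSelfAdjoint
  have hk2 : star k = k := hks
  have hu : star (a * k * r) * (a * k * r) = r := by
    calc _ = star r * (star k * (star a * a) * k * r) := by simp only [star_mul]; noncomm_ring
      _ = _ := by rw [hk2, hkr, hr2, hr1]
  have hap : a * p = a := by simp only [a, mul_assoc, hp1]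
  have hpr : p * r = r := by
    have hpa : p * star a = star a := by
      have := congrArg star hap
      rwa [star_mul, hp2] at this
    have e : r = star a * a * k * k * r := by rw [← hkc.eq]; exact hkr.symm
    calc p * r = (p * star a) * a * k * k * r := by nth_rw 1 [e]; noncomm_ring
      _ = r := by rw [hpa]; exact e.symm
  have hrp : r * p = r := by
    have := congrArg star hpr
    rwa [star_mul, hp2, hr2] at this
  refine ⟨a * k * r, mul_mem (mul_mem ha hk) hr, ?_, by rw [hu]; exact hrr, ?_, ?_⟩
  · intro h0
    rw [h0, mul_zero] at hu
    exact hr0 hu.symm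
  · rw [mul_assoc, hrp]
  · simp only [a, ← mul_assoc, hq1]

/-- Unit vectors in the ranges give vector states at mutual distance at least `1`: the difference of
those at `s` and `t` takes the value `1` on the contraction `s`. A separable metric space has only
countably many such points. -/
theorem countable_of_orthogonal_projections (hsep : M.HasSeparablePredual)
    (𝒮 : Set (K →L[ℂ] K)) (h𝒮 : ∀ s ∈ 𝒮, s ∈ M ∧ IsStarProjection s ∧ s ≠ 0)
    (horth : 𝒮.Pairwise fun s t => s * t = 0) : 𝒮.Countable := by
  have hvec : ∀ s : 𝒮, ∃ ξ : K, ‖ξ‖ = 1 ∧ s.1 ξ = ξ := by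
    rintro ⟨s, hs⟩
    obtain ⟨-, hs1, hs0⟩ := h𝒮 s hs
    obtain ⟨ζ, hζ⟩ : ∃ ζ, s ζ ≠ 0 := by
      by_contra! h
      exact hs0 (ContinuousLinearMap.ext h)
    refine ⟨(‖s ζ‖⁻¹ : ℂ) • s ζ, ?_, ?_⟩
    · rw [norm_smul, norm_inv, Complex.norm_real, norm_norm, inv_mul_cancel₀ (norm_ne_zero_iff.2 hζ)]
    · have : s (s ζ) = s ζ := DFunLike.congr_fun hs1.isIdempotentElem ζ
      simp only [map_smul, this]
  choose ξ hξ1 hξ2 using hvec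
  let ω : 𝒮 → StrongDual ℂ M.toStarSubalgebra := fun s =>
    LinearMap.mkContinuous
      { toFun := fun x => ⟪ξ s, x.1 (ξ s)⟫_ℂ
        map_add' := fun x y => by simp
        map_smul' := fun c x => by simp } 1 (fun x => by
          have h1 : ‖x.1 (ξ s)‖ ≤ ‖x.1‖ * ‖ξ s‖ := x.1.le_opNorm _
          have h2 := norm_inner_le_norm (𝕜 := ℂ) (ξ s) (x.1 (ξ s))
          rw [hξ1, one_mul] at h2
          rw [hξ1, mul_one] at h1
          rw [one_mul]
          exact h2.trans h1)
  have hωapp : ∀ s (x : M.toStarSubalgebra), ω s x = ⟪ξ s, x.1 (ξ s)⟫_ℂ := fun _ _ => rfl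
  have hω : ∀ s, ω s ∈ M.predual := by
    intro s
    have hη : ∀ (n : ℕ), n ∉ ({0} : Finset ℕ) → (Pi.single 0 (ξ s) : ℕ → K) n = 0 := by
      intro n hn
      simp only [Finset.mem_singleton] at hn
      simp [hn]
    have hsum : Summable fun n => ‖(Pi.single 0 (ξ s) : ℕ → K) n‖ ^ 2 :=
      summable_of_ne_finset_zero (s := {0}) fun n hn => by simp [hη n hn]
    have hcont : Continuous[sigmaWeakTopology K, inferInstance]
        (fun x : K →L[ℂ] K => ⟪ξ s, x (ξ s)⟫_ℂ) := by
      have h1 : (fun x : K →L[ℂ] K => ⟪ξ s, x (ξ s)⟫_ℂ) = fun x : K →L[ℂ] K =>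
          ∑' n, ⟪(Pi.single 0 (ξ s) : ℕ → K) n, x ((Pi.single 0 (ξ s) : ℕ → K) n)⟫_ℂ := by
        funext x
        rw [tsum_eq_sum (s := {0}) fun n hn => by simp [hη n hn]]
        simp
      rw [h1]
      refine continuous_iInf_dom (i := Pi.single 0 (ξ s)) (continuous_iInf_dom
        (i := Pi.single 0 (ξ s)) (continuous_iInf_dom (i := hsum) (continuous_iInf_dom
          (i := hsum) continuous_induced_dom)))
    exact @Continuous.comp _ _ _ (TopologicalSpace.induced Subtype.val (sigmaWeakTopology K))
      (sigmaWeakTopology K) _ _ _ hcont continuous_induced_dom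
  obtain ⟨c, hc, hcl⟩ := hsep
  have hd : ∀ s, ∃ d ∈ c, dist (ω s) d < 1 / 2 := fun s =>
    Metric.mem_closure_iff.1 (hcl (hω s)) _ (by norm_num)
  choose d hdc hdd using hd
  have hinj : Function.Injective d := by
    intro s t hst
    by_contra hne
    have hst0 : s.1 * t.1 = 0 := horth s.2 t.2 fun h => hne (Subtype.ext h)
    have h1 : ‖ω s - ω t‖ < 1 := by
      rw [← dist_eq_norm]
      calc dist (ω s) (ω t) ≤ dist (ω s) (d s) + dist (ω t) (d s) := dist_triangle_right _ _ _
        _ < 1 / 2 + 1 / 2 := add_lt_add (hdd s) (by rw [hst]; exact hdd t)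
        _ = 1 := by norm_num
    have h2 : (ω s - ω t) ⟨s.1, (h𝒮 s.1 s.2).1⟩ = 1 := by
      have h3 : s.1 (ξ t) = 0 := by
        rw [← hξ2 t]
        exact DFunLike.congr_fun hst0 (ξ t)
      rw [sub_apply, hωapp, hωapp, hξ2, h3, inner_zero_right, sub_zero,
        inner_self_eq_norm_sq_to_K, hξ1]
      simp
    have h3 := (ω s - ω t).le_opNorm ⟨s.1, (h𝒮 s.1 s.2).1⟩
    have h4 : ‖(⟨s.1, (h𝒮 s.1 s.2).1⟩ : M.toStarSubalgebra)‖ ≤ 1 :=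
      IsStarProjection.norm_le s.1 (h𝒮 s.1 s.2).2.1
    rw [h2, norm_one] at h3
    nlinarith [norm_nonneg (ω s - ω t)]
  have : Countable c := hc.to_subtype
  have hinj' : Function.Injective fun s : 𝒮 => (⟨d s, hdc s⟩ : c) := fun s t h =>
    hinj (congrArg Subtype.val h)
  exact Set.countable_coe_iff.1 hinj'.countable

end VonNeumannAlgebra

/-! ### Equivalence of projections in type III factors -/

namespace VonNeumannAlgebra

variable {K : Type*} [NormedAddCommGroup K] [InnerProductSpace ℂ K] [CompleteSpace K]
  {M : VonNeumannAlgebra K}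

/-- Since `e` is infinite, some `w` maps it onto a proper subprojection, and `r = e - w w*` is
wandering: the `wⁿ r` are partial isometries with initial projection `r` and orthogonal ranges below
`e`. -/
theorem IsTypeIIIFactor.exists_shift (hM : M.IsTypeIIIFactor) {e : K →L[ℂ] K} (he : e ∈ M)
    (hee : IsStarProjection e) (he0 : e ≠ 0) :
    ∃ r ∈ M, IsStarProjection r ∧ r ≠ 0 ∧ ∃ w : ℕ → K →L[ℂ] K, (∀ n, w n ∈ M) ∧
      (∀ n, star (w n) * w n = r) ∧ (∀ n m, n ≠ m → star (w n) * w m = 0) ∧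
      ∀ n, e * w n = w n := by
  have hinf : ¬ M.IsFiniteProjection e := fun h => he0 (hM.2 e he hee h)
  simp only [IsFiniteProjection, not_forall] at hinf
  obtain ⟨w, hw, hwe, hle, hne⟩ := hinf
  have hww : IsStarProjection (w * star w) := isStarProjection_mul_star hee hwe
  have he1 : e * e = e := hee.isIdempotentElem
  have he2 : star e = e := hee.isSelfAdjoint
  have hwe1 : w * e = w := mul_eq_self_of_star_mul_self hee hwe
  have hwww : w * star w * w = w := by rw [mul_assoc, hwe, hwe1]
  have heww : e * (w * star w) = w * star w := (hww.le_iff_mul_eq_right hee).1 hle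
  have hew : e * w = w := by
    calc e * w = e * (w * star w) * w := by rw [mul_assoc e, hwww]
      _ = w := by rw [heww, hwww]
  have hse : star w * e = star w := by rw [← he2, ← star_mul, hew]
  have hwwe : w * star w * e = w * star w := by rw [mul_assoc, hse]
  set r := e - w * star w with hr
  have hrr : IsStarProjection r := by
    refine ⟨?_, ?_⟩
    · change r * r = r
      rw [hr, mul_sub, sub_mul, sub_mul, he1, hwwe, heww]
      have : w * star w * (w * star w) = w * star w := hww.isIdempotentElem
      rw [this]; abel
    · change star r = r
      rw [hr, star_sub, he2, star_mul, star_star]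
  have hr1 : r * r = r := hrr.isIdempotentElem
  have hr2 : star r = r := hrr.isSelfAdjoint
  have hr0 : r ≠ 0 := fun h => hne (sub_eq_zero.1 h).symm
  have her : e * r = r := by rw [hr, mul_sub, he1, heww]
  have hrw : r * w = 0 := by rw [hr, sub_mul, hew, hwww, sub_self]
  have hpow : ∀ n, e * (w ^ n * r) = w ^ n * r := by
    intro n
    cases n with
    | zero => simpa using her
    | succ n => rw [pow_succ', ← mul_assoc, ← mul_assoc, hew]
  have hstar : ∀ n, star (w ^ (n + 1) * r) = star (w ^ n * r) * star w := by
    intro n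
    rw [pow_succ', ← star_mul, mul_assoc]
  have hdiag : ∀ n, star (w ^ n * r) * (w ^ n * r) = r := by
    intro n
    induction n with
    | zero => simp [hr1, hr2]
    | succ n ih =>
      rw [hstar, pow_succ', mul_assoc w, mul_assoc, ← mul_assoc (star w), hwe, hpow, ih]
  have hoff : ∀ n k, star (w ^ n * r) * (w ^ (n + (k + 1)) * r) = 0 := by
    intro n k
    induction n with
    | zero =>
      rw [pow_zero, one_mul, hr2, zero_add, pow_succ', mul_assoc w, ← mul_assoc, hrw, zero_mul]
    | succ n ih =>
      rw [hstar, show n + 1 + (k + 1) = (n + (k + 1)) + 1 by ring, pow_succ', mul_assoc w,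
        mul_assoc, ← mul_assoc (star w), hwe, hpow, ih]
  refine ⟨r, sub_mem he (mul_mem hw (star_mem hw)), hrr, hr0, fun n => w ^ n * r,
    fun n => mul_mem (pow_mem hw n) (sub_mem he (mul_mem hw (star_mem hw))), hdiag, ?_, hpow⟩
  intro n m hnm
  rcases lt_or_gt_of_ne hnm with h | h
  · obtain ⟨k, rfl⟩ := Nat.exists_eq_add_of_lt h
    exact hoff n k
  · obtain ⟨k, rfl⟩ := Nat.exists_eq_add_of_lt h
    have := congrArg star (hoff m k)
    rw [star_mul, star_star, star_zero] at this
    exact this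

/-- The sum of a family of partial isometries with orthogonal supports and orthogonal ranges. -/
theorem exists_sum_partialIsometry {ι : Type*} (a : ι → K →L[ℂ] K) (ha : ∀ i, a i ∈ M)
    (hproj : ∀ i, IsStarProjection (star (a i) * a i))
    (h1 : ∀ i j, i ≠ j → star (a i) * a j = 0) (h2 : ∀ i j, i ≠ j → a i * star (a j) = 0) :
    ∃ T ∈ M, (∀ i, star (a i) * T = star (a i) * a i) ∧
      (∀ i, T * (star (a i) * a i) = a i) ∧ ∀ e, (∀ i, e * a i = a i) → e * T = T := by
  classical
  have hsum : ∀ s : Finset ι, star (∑ i ∈ s, a i) * ∑ i ∈ s, a i = ∑ i ∈ s, star (a i) * a i := by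
    intro s
    rw [star_sum, Finset.sum_mul_sum]
    refine Finset.sum_congr rfl fun i hi => ?_
    exact Finset.sum_eq_single_of_mem i hi fun j _ hj => h1 i j hj.symm
  have hq : ∀ i j, i ≠ j → (star (a i) * a i) * (star (a j) * a j) = 0 := by
    intro i j hij
    rw [mul_assoc, ← mul_assoc (a i), h2 i j hij, zero_mul, mul_zero]
  have hnorm : ∀ s : Finset ι, ‖∑ i ∈ s, a i‖ ≤ 1 := by
    intro s
    have hp : IsStarProjection (∑ i ∈ s, star (a i) * a i) := by
      refine ⟨?_, ?_⟩
      · change _ * _ = _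
        rw [Finset.sum_mul_sum]
        refine Finset.sum_congr rfl fun i hi => ?_
        rw [Finset.sum_eq_single_of_mem i hi fun j _ hj => hq i j hj.symm]
        exact (hproj i).isIdempotentElem
      · change star _ = _
        rw [star_sum]
        exact Finset.sum_congr rfl fun i _ => (hproj i).isSelfAdjoint
    have h := IsStarProjection.norm_le _ hp
    rw [← hsum, CStarRing.norm_star_mul_self] at h
    nlinarith [norm_nonneg (∑ i ∈ s, a i)]
  -- The finite sums are partial isometries, so they stay in the unit ball and have a weak limit.
  -- Each required product is eventually constant along the finite sets.
  let U : Ultrafilter (Finset ι) := Ultrafilter.of Filter.atTop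
  have hU : (U : Filter (Finset ι)) ≤ Filter.atTop := Ultrafilter.of_le _
  obtain ⟨T, -, hT⟩ := exists_weakTendsto_of_ultrafilter U (fun s => ∑ i ∈ s, a i) zero_le_one
    (Filter.Eventually.of_forall hnorm)
  refine ⟨T, hT.mem (Filter.Eventually.of_forall fun s => sum_mem fun i _ => ha i), ?_, ?_, ?_⟩
  · intro i
    refine (hT.mul_left (star (a i))).unique ((WeakTendsto.const _ _).congr' ?_)
    refine hU ((Filter.eventually_ge_atTop {i}).mono fun s hs => ?_)
    dsimp only
    rw [Finset.mul_sum,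
      Finset.sum_eq_single_of_mem i (Finset.singleton_subset_iff.1 hs) fun j _ hj => h1 i j hj.symm]
  · intro i
    refine (hT.mul_right (star (a i) * a i)).unique ((WeakTendsto.const _ _).congr' ?_)
    refine hU ((Filter.eventually_ge_atTop {i}).mono fun s hs => ?_)
    dsimp only
    rw [Finset.sum_mul, Finset.sum_eq_single_of_mem i (Finset.singleton_subset_iff.1 hs) fun j _ hj
      => by rw [← mul_assoc, h2 j i hj, zero_mul]]
    exact (mul_eq_self_of_star_mul_self (hproj i) rfl).symm
  · intro e he
    refine (hT.mul_left e).unique (hT.congr' (Filter.Eventually.of_forall fun s => ?_))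
    simp only [Finset.mul_sum, he]

/-- A projection containing the range of an isometry of `M` is equivalent to the identity. -/
theorem exists_isometry_range_eq {t e : K →L[ℂ] K} (ht : t ∈ M) (he : e ∈ M)
    (hee : IsStarProjection e) (htt : star t * t = 1) (het : e * t = t) :
    ∃ v ∈ M, star v * v = 1 ∧ v * star v = e := by
  set r := 1 - e with hr
  have hrM : r ∈ M := sub_mem (one_mem M) he
  have hrr : IsStarProjection r := hee.one_sub
  have hr1 : r * r = r := hrr.isIdempotentElem
  have hr2 : star r = r := hrr.isSelfAdjoint
  have hrt : r * t = 0 := by rw [hr, sub_mul, one_mul, het, sub_self]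
  have htr : star t * r = 0 := by
    have := congrArg star hrt
    rwa [star_mul, hr2, star_zero] at this
  -- The Cantor–Bernstein argument: `R = ∑ tⁿ r t*ⁿ` is the projection onto the orbit of `r = 1 - e`
  -- under `t`. The operator `t R + (1 - R)` shifts this orbit by one step and fixes its complement,
  -- so exactly `r` is missing from its range.
  let S : Submodule ℂ K :=
    (Submodule.span ℂ {ζ : K | ∃ n : ℕ, ∃ ξ, ζ = (t ^ n * r) ξ}).topologicalClosure
  have hScl : IsClosed (S : Set K) := Submodule.isClosed_topologicalClosure _
  have : CompleteSpace S := hScl.completeSpace_coe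
  have hmem : ∀ n ξ, (t ^ n * r) ξ ∈ S := fun n ξ =>
    Submodule.le_topologicalClosure _ (Submodule.subset_span ⟨n, ξ, rfl⟩)
  have hind : ∀ y : K →L[ℂ] K, ∀ C : Submodule ℂ K, IsClosed (C : Set K) →
      (∀ n ξ, y ((t ^ n * r) ξ) ∈ C) → ∀ ξ ∈ S, y ξ ∈ C := by
    intro y C hC hy ξ hξ
    have h1 : Submodule.span ℂ {ζ : K | ∃ n : ℕ, ∃ ξ, ζ = (t ^ n * r) ξ} ≤
        C.comap (y : K →ₗ[ℂ] K) := by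
      rw [Submodule.span_le]
      rintro _ ⟨n, ζ, rfl⟩
      exact hy n ζ
    exact Submodule.topologicalClosure_minimal _ h1 (hC.preimage y.continuous) hξ
  set R := S.starProjection
  have hRM : R ∈ M := starProjection_mem S fun y hy => hind y S hScl fun n ξ => by
    have h1 := DFunLike.congr_fun
      ((mem_iff_forall_commute M).1 (mul_mem (pow_mem ht n) hrM) y hy).eq ξ
    have h2 : y ((t ^ n * r) ξ) = (t ^ n * r) (y ξ) := h1
    rw [h2]
    exact hmem n _
  have hRR : IsStarProjection R := isStarProjection_starProjection
  have hR1 : R * R = R := hRR.isIdempotentElem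
  have hR2 : star R = R := hRR.isSelfAdjoint
  have hRof : ∀ y : K →L[ℂ] K, (∀ ξ, y ξ ∈ S) → R * y = y := fun y hy =>
    ContinuousLinearMap.ext fun ξ => Submodule.starProjection_eq_self_iff.2 (hy ξ)
  have hofR : ∀ y : K →L[ℂ] K, (∀ n, y * (t ^ n * r) = t ^ n * r) → y * R = R := by
    intro y hy
    have h1 : ∀ ξ ∈ S, (y - 1) ξ ∈ (⊥ : Submodule ℂ K) := by
      refine hind (y - 1) ⊥ isClosed_singleton fun n ξ => ?_
      have := DFunLike.congr_fun (hy n) ξ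
      rw [Submodule.mem_bot, sub_apply, sub_eq_zero]
      exact this
    ext ξ
    have := h1 _ (Submodule.starProjection_apply_mem S ξ)
    rw [Submodule.mem_bot, sub_apply, sub_eq_zero] at this
    exact this
  have hRr : R * r = r := hRof r fun ξ => by simpa using hmem 0 ξ
  have hRtR : R * (t * R) = t * R := hRof _ fun ξ =>
    hind t S hScl (fun n ζ => by
      have := hmem (n + 1) ζ
      rwa [pow_succ', mul_assoc] at this) _ (Submodule.starProjection_apply_mem S ξ)
  have hRt : ∀ n, R * (t ^ n * r) = t ^ n * r := fun n => hRof _ (hmem n)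
  -- The orbit of `r` is `r` together with its image under `t`. Both sides are self-adjoint; the
  -- left side fixes the orbit and has its range in it.
  have hdec : r + t * R * star t = R := by
    set R' := r + t * R * star t with hR'
    have hsa : star R' = R' := by
      rw [hR', star_add, hr2, star_mul, star_star, star_mul, hR2, mul_assoc]
    have h1 : R' * R = R := hofR R' fun n => by
      cases n with
      | zero => rw [pow_zero, one_mul, hR', add_mul, hr1, mul_assoc, htr, mul_zero, add_zero]
      | succ n =>
        rw [pow_succ', mul_assoc t, hR', add_mul, ← mul_assoc r, hrt, zero_mul, zero_add,
          mul_assoc, ← mul_assoc (star t), htt, one_mul, mul_assoc, hRt]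
    have h2 : R * R' = R' := by
      rw [hR', mul_add, hRr, ← mul_assoc, hRtR]
    have h3 := congrArg star h1
    rw [star_mul, hR2, hsa] at h3
    rw [← h2, h3]
  have hcross : (1 - R) * (t * R) = 0 := by rw [sub_mul, one_mul, hRtR, sub_self]
  have hcross' : R * star t * (1 - R) = 0 := by
    have := congrArg star hcross
    rwa [star_mul, star_mul, star_sub, star_one, hR2, star_zero] at this
  have hRc : R * (1 - R) = 0 := hRR.mul_one_sub_self
  have hRc' : (1 - R) * R = 0 := hRR.one_sub_mul_self
  have hcc : (1 - R) * (1 - R) = 1 - R := hRR.one_sub.isIdempotentElem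
  have hsv : star (t * R + (1 - R)) = R * star t + (1 - R) := by
    rw [star_add, star_mul, star_sub, star_one, hR2]
  refine ⟨t * R + (1 - R), add_mem (mul_mem ht hRM) (sub_mem (one_mem M) hRM), ?_, ?_⟩
  · rw [hsv]
    calc _ = R * (star t * t) * R + R * star t * (1 - R) + (1 - R) * (t * R)
          + (1 - R) * (1 - R) := by noncomm_ring
      _ = 1 := by rw [htt, hcross, hcross', hcc, mul_one, hR1]; abel
  · rw [hsv]
    calc _ = t * (R * R) * star t + t * (R * (1 - R)) + ((1 - R) * R) * star t
          + (1 - R) * (1 - R) := by noncomm_ring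
      _ = (r + t * R * star t) - r + (1 - R) := by rw [hR1, hRc, hRc', hcc]; noncomm_ring
      _ = e := by rw [hdec, hr]; abel

/-- In a type III factor with separable predual, all nonzero projections are equivalent. -/
theorem IsTypeIIIFactor.exists_isometry (hM : M.IsTypeIIIFactor) (hsep : M.HasSeparablePredual)
    {e : K →L[ℂ] K} (he : e ∈ M) (hee : IsStarProjection e) (he0 : e ≠ 0) :
    ∃ v ∈ M, star v * v = 1 ∧ v * star v = e := by
  obtain ⟨r, hr, hrr, hr0, w, hw, hww, hwo, hew⟩ := hM.exists_shift he hee he0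
  -- A maximal family of partial isometries with orthogonal initial projections and ranges below
  -- `r`. The countably many members are then moved into the disjoint copies `w n r` of `r` below
  -- `e`, and their sum is an isometry `T` with range below `e`.
  let P : Set (Set (K →L[ℂ] K)) := {𝒮 | (∀ u ∈ 𝒮, u ∈ M ∧ u ≠ 0 ∧ IsStarProjection (star u * u) ∧
    r * u = u) ∧ 𝒮.Pairwise fun u v => u * star v = 0}
  obtain ⟨𝒮, hmax⟩ := zorn_subset P (by
    intro c hc hchain
    refine ⟨⋃₀ c, ⟨?_, ?_⟩, fun s hs => Set.subset_sUnion_of_mem hs⟩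
    · rintro u ⟨s, hs, hus⟩
      exact (hc hs).1 u hus
    · rintro u ⟨s, hs, hus⟩ v ⟨s', hs', hvs⟩ huv
      rcases hchain.total hs hs' with h | h
      · exact (hc hs').2 (h hus) hvs huv
      · exact (hc hs).2 hus (h hvs) huv)
  obtain ⟨h𝒮, h𝒮o⟩ := hmax.prop
  have hsupp : ∀ u ∈ 𝒮, u * (star u * u) = u := fun u hu =>
    mul_eq_self_of_star_mul_self (h𝒮 u hu).2.2.1 rfl
  have hinj : Set.InjOn (fun u => star u * u) 𝒮 := by
    intro u hu v hv huv
    by_contra hne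
    have h1 : star u * u = star v * v := huv
    apply (h𝒮 u hu).2.1
    rw [← hsupp u hu, h1, ← mul_assoc, h𝒮o hu hv hne, zero_mul]
  have hcount : 𝒮.Countable := by
    refine Set.countable_of_injective_of_countable_image hinj
      (countable_of_orthogonal_projections hsep _ ?_ ?_)
    · rintro _ ⟨u, hu, rfl⟩
      exact ⟨mul_mem (star_mem (h𝒮 u hu).1) (h𝒮 u hu).1, (h𝒮 u hu).2.2.1, fun h =>
        (h𝒮 u hu).2.1 ((CStarRing.star_mul_self_eq_zero_iff _).1 h)⟩
    · rintro _ ⟨u, hu, rfl⟩ _ ⟨v, hv, rfl⟩ huv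
      have : u ≠ v := fun h => huv (by rw [h])
      change star u * u * (star v * v) = 0
      rw [mul_assoc, ← mul_assoc u, h𝒮o hu hv this, zero_mul, mul_zero]
  have : Countable 𝒮 := hcount.to_subtype
  obtain ⟨n, hn⟩ := exists_injective_nat 𝒮
  have haa : ∀ u v : 𝒮, star (w (n u) * u.1) * (w (n v) * v.1) =
      star u.1 * (star (w (n u)) * w (n v)) * v.1 := fun u v => by
    rw [star_mul]; noncomm_ring
  have hdiag : ∀ u : 𝒮, star (w (n u) * u.1) * (w (n u) * u.1) = star u.1 * u.1 := fun u => by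
    rw [haa, hww, mul_assoc, (h𝒮 u u.2).2.2.2]
  obtain ⟨T, hT, hT', hTa, hTe⟩ := exists_sum_partialIsometry (M := M)
    (fun u : 𝒮 => w (n u) * u.1) (fun u => mul_mem (hw _) (h𝒮 u u.2).1)
    (fun u => by rw [hdiag]; exact (h𝒮 u u.2).2.2.1)
    (fun u v huv => by rw [haa, hwo _ _ (hn.ne huv), mul_zero, zero_mul])
    (fun u v huv => by
      rw [star_mul, mul_assoc, ← mul_assoc u.1, h𝒮o u.2 v.2 fun h => huv (Subtype.ext h),
        zero_mul, mul_zero])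
  let S : Submodule ℂ K :=
    (Submodule.span ℂ {ζ : K | ∃ u ∈ 𝒮, ∃ ξ, ζ = star u ξ}).topologicalClosure
  have hScl : IsClosed (S : Set K) := Submodule.isClosed_topologicalClosure _
  have : CompleteSpace S := hScl.completeSpace_coe
  have hmem : ∀ u ∈ 𝒮, ∀ ξ, star u ξ ∈ S := fun u hu ξ =>
    Submodule.le_topologicalClosure _ (Submodule.subset_span ⟨u, hu, ξ, rfl⟩)
  have hind : ∀ y : K →L[ℂ] K, ∀ C : Submodule ℂ K, IsClosed (C : Set K) →
      (∀ u ∈ 𝒮, ∀ ξ, y (star u ξ) ∈ C) → ∀ ξ ∈ S, y ξ ∈ C := by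
    intro y C hC hy ξ hξ
    have h1 : Submodule.span ℂ {ζ : K | ∃ u ∈ 𝒮, ∃ ξ, ζ = star u ξ} ≤
        C.comap (y : K →ₗ[ℂ] K) := by
      rw [Submodule.span_le]
      rintro _ ⟨u, hu, ζ, rfl⟩
      exact hy u hu ζ
    exact Submodule.topologicalClosure_minimal _ h1 (hC.preimage y.continuous) hξ
  set Q := S.starProjection
  have hQM : Q ∈ M := starProjection_mem S fun y hy => hind y S hScl fun u hu ξ => by
    have h1 := DFunLike.congr_fun
      ((mem_iff_forall_commute M).1 (star_mem (h𝒮 u hu).1) y hy).eq ξ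
    have h2 : y (star u ξ) = star u (y ξ) := h1
    rw [h2]
    exact hmem u hu _
  have hQQ : IsStarProjection Q := isStarProjection_starProjection
  -- The initial projections exhaust `1`: otherwise comparison of `1 - Q` with `r` would enlarge the
  -- maximal family.
  have hQ1 : 1 - Q = 0 := by
    by_contra hne
    obtain ⟨u₀, hu₀, hu₀0, hu₀p, hu₀Q, hru₀⟩ := hM.1.exists_partialIsometry
      (sub_mem (one_mem M) hQM) hQQ.one_sub hr hrr hne hr0
    have horth : ∀ u ∈ 𝒮, u₀ * star u = 0 := by
      intro u hu
      have h1 : Q * star u = star u := ContinuousLinearMap.ext fun ξ =>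
        Submodule.starProjection_eq_self_iff.2 (hmem u hu ξ)
      rw [← hu₀Q, mul_assoc, sub_mul, one_mul, h1, sub_self, mul_zero]
    have horth' : ∀ u ∈ 𝒮, u * star u₀ = 0 := by
      intro u hu
      have := congrArg star (horth u hu)
      rwa [star_mul, star_star, star_zero] at this
    have hins : insert u₀ 𝒮 ∈ P := by
      refine ⟨?_, ?_⟩
      · rintro u (rfl | hu)
        · exact ⟨hu₀, hu₀0, hu₀p, hru₀⟩
        · exact h𝒮 u hu
      · rw [Set.pairwise_insert]
        exact ⟨h𝒮o, fun u hu _ => ⟨horth u hu, horth' u hu⟩⟩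
    have hu₀𝒮 : u₀ ∈ 𝒮 := hmax.le_of_ge hins (Set.subset_insert _ _) (Set.mem_insert _ _)
    exact hu₀0 ((CStarRing.mul_star_self_eq_zero_iff _).1 (horth u₀ hu₀𝒮))
  have hTT : star T * T = 1 := by
    have h1 : ∀ u ∈ 𝒮, (star T * T - 1) * star u = 0 := by
      intro u hu
      have h2 := hTa ⟨u, hu⟩
      have h3 := congrArg star (hT' ⟨u, hu⟩)
      rw [hdiag] at h2 h3
      rw [star_mul, star_star, star_mul, star_star] at h3
      have h4 : (star T * T - 1) * (star u * u) = 0 := by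
        rw [sub_mul, one_mul, mul_assoc, h2]
        exact sub_eq_zero.2 h3
      have h5 : star u = star u * u * star u := by
        have := congrArg star (hsupp u hu)
        rw [star_mul, star_mul, star_star] at this
        exact this.symm
      rw [h5, ← mul_assoc, h4, zero_mul]
    have h2 : ∀ ξ ∈ S, (star T * T - 1) ξ ∈ (⊥ : Submodule ℂ K) :=
      hind _ ⊥ isClosed_singleton fun u hu ξ => DFunLike.congr_fun (h1 u hu) ξ
    ext ξ
    have h3 : Q ξ = ξ := by
      rw [← sub_eq_zero.1 hQ1]
      rfl
    have h4 := h2 (Q ξ) (Submodule.starProjection_apply_mem S ξ)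
    rw [h3, Submodule.mem_bot, sub_apply, sub_eq_zero] at h4
    exact h4
  exact exists_isometry_range_eq hT he hee hTT
    (hTe e fun u => by rw [← mul_assoc, hew])

end VonNeumannAlgebra

/-! ### Operator inequalities for perturbing a non-extreme point -/

section Order

variable {K : Type*} [NormedAddCommGroup K] [InnerProductSpace ℂ K] [CompleteSpace K]

theorem nonneg_iff_forall_inner {T : K →L[ℂ] K} : 0 ≤ T ↔ ∀ ξ, 0 ≤ ⟪ξ, T ξ⟫_ℂ := by
  rw [ContinuousLinearMap.nonneg_iff_isPositive]
  refine ⟨fun h ξ => h.inner_nonneg_right ξ, fun h => ?_⟩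
  rw [ContinuousLinearMap.isPositive_iff_complex]
  intro ξ
  have h1 : 0 ≤ ⟪T ξ, ξ⟫_ℂ := by
    rw [← inner_conj_symm, starRingEnd_apply, star_nonneg_iff]
    exact h ξ
  have h2 := RCLike.nonneg_iff.1 h1
  exact ⟨by rw [← RCLike.re_add_im (⟪T ξ, ξ⟫_ℂ), h2.2]; simp, h2.1⟩

theorem WeakTendsto.nonneg {ι : Type*} {f : ι → K →L[ℂ] K} {l : Filter ι} [l.NeBot]
    {x : K →L[ℂ] K} (h : WeakTendsto f l x) (hf : ∀ᶠ i in l, 0 ≤ f i) : 0 ≤ x :=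
  nonneg_iff_forall_inner.2 fun ξ =>
    ge_of_tendsto (h ξ ξ) (hf.mono fun _ hi => nonneg_iff_forall_inner.1 hi ξ)

theorem WeakTendsto.sub {ι : Type*} {f g : ι → K →L[ℂ] K} {l : Filter ι}
    {x y : K →L[ℂ] K} (h : WeakTendsto f l x) (h' : WeakTendsto g l y) :
    WeakTendsto (fun i => f i - g i) l (x - y) := fun ξ η => by
  simpa only [sub_apply, inner_sub_right] using (h ξ η).sub (h' ξ η)

end Order

section Extreme

variable {A : Type*} [CStarAlgebra A] [PartialOrder A] [StarOrderedRing A]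

theorem IsSelfAdjoint.le_one_of_norm_le {z : A} (hz : IsSelfAdjoint z) (h : ‖z‖ ≤ 1) : z ≤ 1 := by
  refine hz.le_algebraMap_norm_self.trans ?_
  rw [← (algebraMap ℝ A).map_one]
  exact algebraMap_mono A h

/-- The scalar inequality `t² (1 - t)² ≤ t` on `[0, 1]`, obtained by exhibiting the difference as a
sum of conjugates of positive elements. -/
theorem sq_sub_sq_le {x : A} (h0 : 0 ≤ x) (h1 : x ≤ 1) : (x - x * x) * (x - x * x) ≤ x := by
  have hx : IsSelfAdjoint x := .of_nonneg h0
  have ha : 0 ≤ x - x * x := by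
    have e : x - x * x = x * (1 - x) * x + (1 - x) * x * (1 - x) := by noncomm_ring
    rw [e]
    exact add_nonneg (IsSelfAdjoint.conjugate_nonneg (sub_nonneg.2 h1) hx)
      (IsSelfAdjoint.conjugate_nonneg h0 ((IsSelfAdjoint.one A).sub hx))
  have hb : 0 ≤ x * (x + (x - x * x)) * x := IsSelfAdjoint.conjugate_nonneg (add_nonneg h0 ha) hx
  rw [← sub_nonneg]
  have e : x - (x - x * x) * (x - x * x) = (x - x * x) + x * (x + (x - x * x)) * x := by
    noncomm_ring
  rw [e]
  exact add_nonneg ha hb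

/-- Since `x - x²` is unchanged under `x ↦ 1 - x`, applying this to `±z` and to both `x` and `1 - x`
keeps `x ± (x - x²) z (x - x²)` between `0` and `1`. -/
theorem conjugate_sub_sq_le {x z : A} (h0 : 0 ≤ x) (h1 : x ≤ 1) (hz : IsSelfAdjoint z)
    (hz1 : ‖z‖ ≤ 1) : (x - x * x) * z * (x - x * x) ≤ x := by
  have hx : IsSelfAdjoint x := .of_nonneg h0
  have hh : IsSelfAdjoint (x - x * x) := hx.sub (by
    change star _ = _
    rw [star_mul, hx.star_eq])
  refine (IsSelfAdjoint.conjugate_le_conjugate (hz.le_one_of_norm_le hz1) hh).trans ?_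
  rw [mul_one]
  exact sq_sub_sq_le h0 h1

end Extreme

/-! ### Lyapunov's theorem for normal functionals -/

namespace VonNeumannAlgebra

variable {K : Type*} [NormedAddCommGroup K] [InnerProductSpace ℂ K] [CompleteSpace K]

/-- Continuity, for the weak operator topology, on the bounded subsets of `M`. -/
def BddWeakContinuousOn (M : VonNeumannAlgebra K) (f : (K →L[ℂ] K) →ₗ[ℂ] ℂ) : Prop :=
  ∀ (l : Filter (K →L[ℂ] K)) (x : K →L[ℂ] K) (R : ℝ), (∀ᶠ y in l, y ∈ M) →
    (∀ᶠ y in l, ‖y‖ ≤ R) → WeakTendsto id l x → Filter.Tendsto f l (𝓝 (f x))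

variable {M : VonNeumannAlgebra K}

theorem BddWeakContinuousOn.tendsto {f : (K →L[ℂ] K) →ₗ[ℂ] ℂ} (hf : M.BddWeakContinuousOn f)
    {ι : Type*} {l : Filter ι} {g : ι → K →L[ℂ] K} {x : K →L[ℂ] K} {R : ℝ}
    (hM : ∀ᶠ i in l, g i ∈ M) (hR : ∀ᶠ i in l, ‖g i‖ ≤ R) (h : WeakTendsto g l x) :
    Filter.Tendsto (fun i => f (g i)) l (𝓝 (f x)) :=
  (hf (l.map g) x R hM hR fun ξ η => Filter.tendsto_map'_iff.2 (h ξ η)).comp Filter.tendsto_map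

theorem BddWeakContinuousOn.mul_mul {f : (K →L[ℂ] K) →ₗ[ℂ] ℂ} (hf : M.BddWeakContinuousOn f)
    {a b : K →L[ℂ] K} (ha : a ∈ M) (hb : b ∈ M) :
    M.BddWeakContinuousOn (f ∘ₗ LinearMap.mulLeftRight ℂ (a, b)) := by
  intro l x R hM hR h
  have := hf.tendsto (g := fun y => a * y * b) (R := ‖a‖ * R * ‖b‖)
    (hM.mono fun y hy => mul_mem (mul_mem ha hy) hb)
    (hR.mono fun y hy => by
      refine (norm_mul_le _ _).trans ?_
      gcongr
      exact (norm_mul_le _ _).trans (by gcongr)) (h.mul_mul a b)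
  simpa [Function.comp_def] using this

/-- Dimension count over `ℝ`: there is one more coefficient than the real dimension of the target.
Real coefficients keep combinations of projections self-adjoint. -/
theorem exists_kernel_combination {ι : Type*} [Finite ι] (f : ι → (K →L[ℂ] K) →ₗ[ℂ] ℂ)
    (a : ℕ → K →L[ℂ] K) : ∃ N : ℕ, ∃ c : Fin N → ℝ, c ≠ 0 ∧
      ∀ i, f i (∑ n, (c n : ℂ) • a n) = 0 := by
  have := Fintype.ofFinite ι
  refine ⟨Module.finrank ℝ (ι → ℂ) + 1, ?_⟩
  let L : (Fin (Module.finrank ℝ (ι → ℂ) + 1) → ℝ) →ₗ[ℝ] (ι → ℂ) :=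
    { toFun := fun c i => f i (∑ n, (c n : ℂ) • a n)
      map_add' := fun c d => by
        funext i
        simp [add_smul, Finset.sum_add_distrib]
      map_smul' := fun r c => by
        funext i
        simp [mul_assoc, Finset.mul_sum] }
  obtain ⟨c, hc, hc0⟩ := (Submodule.ne_bot_iff _).1
    (LinearMap.ker_ne_bot_of_finrank_lt (f := L) (by simp))
  exact ⟨c, hc0, fun i => congrFun hc i⟩

/-- If `h ≠ 0`, the space `hMh` is not separated by finitely many functionals. -/
theorem IsTypeIIIFactor.exists_conjugate_eq_zero (hM : M.IsTypeIIIFactor) {ι : Type*} [Finite ι]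
    (f : ι → (K →L[ℂ] K) →ₗ[ℂ] ℂ) {h : K →L[ℂ] K} (hh : h ∈ M) (h0 : 0 ≤ h) (hne : h ≠ 0) :
    ∃ z ∈ M, IsSelfAdjoint z ∧ ‖z‖ ≤ 1 ∧ h * z * h ≠ 0 ∧ ∀ i, f i (h * z * h) = 0 := by
  obtain ⟨p, hp, hpp, hp0, k, hk, hks, hkc, hkp⟩ := exists_projection_inverting hh h0 hne
  obtain ⟨r, hr, hrr, hr0, w, hw, hww, hwo, hpw⟩ := hM.exists_shift hp hpp hp0
  -- The projections `w n (w n)*` are orthogonal and lie below `p`, so a real combination `y` killed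
  -- by all `f i` is nonzero. As `h k²` is the identity on `p K`, the equation `h z h = y` is solved
  -- by `z = k² y k²`, later scaled to norm at most `1`.
  obtain ⟨N, c, hc, hcf⟩ := exists_kernel_combination f fun n => w n * star (w n)
  set y := ∑ n : Fin N, (c n : ℂ) • (w n * star (w n)) with hy
  have hyM : y ∈ M := sum_mem fun n _ => smul_mem (mul_mem (hw _) (star_mem (hw _))) _
  have hys : star y = y := by
    rw [hy, star_sum]
    refine Finset.sum_congr rfl fun n _ => ?_
    rw [star_smul, star_mul, star_star, Complex.star_def, Complex.conj_ofReal]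
  have hpy : p * y = y := by
    rw [hy, Finset.mul_sum]
    refine Finset.sum_congr rfl fun n _ => ?_
    rw [mul_smul_comm, ← mul_assoc, hpw]
  have hy0 : y ≠ 0 := by
    intro hy0
    obtain ⟨m, hm⟩ : ∃ m, c m ≠ 0 := by
      by_contra! h
      exact hc (funext h)
    have hwr : w m * r = w m := mul_eq_self_of_star_mul_self hrr (hww m)
    have h1 : y * w m = (c m : ℂ) • w m := by
      rw [hy, Finset.sum_mul, Finset.sum_eq_single_of_mem m (Finset.mem_univ _)]
      · rw [smul_mul_assoc, mul_assoc, hww, hwr]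
      · intro n _ hn
        rw [smul_mul_assoc, mul_assoc, hwo _ _ fun h => hn (Fin.ext h), mul_zero, smul_zero]
    rw [hy0, zero_mul] at h1
    have h2 : w m = 0 := (smul_eq_zero.1 h1.symm).resolve_left (by exact_mod_cast hm)
    exact hr0 (by rw [← hww m, h2, mul_zero])
  set z := k * k * y * (k * k) with hz
  have hks' : star k = k := hks
  have hzs : IsSelfAdjoint z := by
    change star z = z
    simp only [hz, star_mul, hks', hys, mul_assoc]
  have hhs : star h = h := (IsSelfAdjoint.of_nonneg h0).star_eq
  have hkk : h * (k * k) * y = y := by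
    calc h * (k * k) * y = k * h * k * (p * y) := by rw [hpy, ← mul_assoc h, ← hkc.eq]
      _ = y := by rw [← mul_assoc, hkp, hpy]
  have hkk' : y * (k * k) * h = y := by
    have := congrArg star hkk
    simpa only [star_mul, hhs, hks', hys, mul_assoc] using this
  have hhz : h * z * h = y := by
    calc h * z * h = (h * (k * k) * y) * (k * k) * h := by rw [hz]; noncomm_ring
      _ = y := by rw [hkk, hkk']
  have hzM : z ∈ M := mul_mem (mul_mem (mul_mem hk hk) hyM) (mul_mem hk hk)
  set δ : ℝ := (1 + ‖z‖)⁻¹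
  have hδ : 0 < δ := by positivity
  have hδy : h * ((δ : ℂ) • z) * h = (δ : ℂ) • y := by
    rw [mul_smul_comm, smul_mul_assoc, hhz]
  refine ⟨(δ : ℂ) • z, smul_mem hzM _, ?_, ?_, ?_, fun i => ?_⟩
  · change star _ = _
    rw [star_smul, hzs.star_eq, Complex.star_def, Complex.conj_ofReal]
  · rw [norm_smul, Complex.norm_real, Real.norm_of_nonneg hδ.le, inv_mul_le_iff₀ (by positivity)]
    linarith
  · rw [hδy]
    exact smul_ne_zero (by exact_mod_cast hδ.ne') hy0
  · rw [hδy, map_smul, hcf, smul_zero]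

/-- **Lyapunov's theorem**: in a type III factor, a tuple of normal functionals takes the same
values on projections as on the multiples `s • 1`. -/
theorem IsTypeIIIFactor.exists_projection_apply_eq (hM : M.IsTypeIIIFactor) {ι : Type*} [Finite ι]
    (f : ι → (K →L[ℂ] K) →ₗ[ℂ] ℂ) (hf : ∀ i, M.BddWeakContinuousOn (f i)) {s : ℝ} (hs0 : 0 ≤ s)
    (hs1 : s ≤ 1) : ∃ p ∈ M, IsStarProjection p ∧ ∀ i, f i p = s * f i 1 := by
  let C : Set (K →L[ℂ] K) := {x | x ∈ M ∧ 0 ≤ x ∧ x ≤ 1 ∧ ∀ i, f i x = s * f i 1}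
  -- Passing to matrix coefficients turns the weak operator topology into a product topology on a
  -- locally convex space. There `C` is compact and has an extreme point.
  let Φ : (K →L[ℂ] K) → K → K → ℂ := fun x ξ η => ⟪ξ, x η⟫_ℂ
  have hne : C.Nonempty := by
    refine ⟨(s : ℂ) • 1, smul_mem (one_mem M) _, ?_, ?_, fun i => by rw [map_smul, smul_eq_mul]⟩
    · exact smul_nonneg (by exact_mod_cast hs0) zero_le_one
    · rw [← sub_nonneg]
      have e : (1 : K →L[ℂ] K) - (s : ℂ) • 1 = ((1 - s : ℝ) : ℂ) • 1 := by
        rw [Complex.ofReal_sub, sub_smul, Complex.ofReal_one, one_smul]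
      rw [e]
      exact smul_nonneg (by exact_mod_cast sub_nonneg.2 hs1) zero_le_one
  have hcomp : IsCompact (Φ '' C) := by
    rw [isCompact_iff_ultrafilter_le_nhds]
    intro V hV
    let g := Function.invFunOn Φ C
    have hg : ∀ᶠ F in (V : Filter (K → K → ℂ)), g F ∈ C ∧ Φ (g F) = F := by
      filter_upwards [hV (Filter.mem_principal_self _)] with F hF
      exact ⟨Function.invFunOn_mem hF, Function.invFunOn_eq hF⟩
    have hgn : ∀ᶠ F in (V : Filter (K → K → ℂ)), ‖g F‖ ≤ 1 := hg.mono fun F hF =>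
      (CStarAlgebra.norm_le_one_iff_of_nonneg _ hF.1.2.1).2 hF.1.2.2.1
    obtain ⟨x, -, hx⟩ := exists_weakTendsto_of_ultrafilter V g zero_le_one hgn
    refine ⟨Φ x, ⟨x, ⟨hx.mem (hg.mono fun F hF => hF.1.1), hx.nonneg (hg.mono fun F hF => hF.1.2.1),
      ?_, fun i => ?_⟩, rfl⟩, ?_⟩
    · rw [← sub_nonneg]
      exact ((WeakTendsto.const 1 _).sub hx).nonneg
        (hg.mono fun F hF => sub_nonneg.2 hF.1.2.2.1)
    · refine tendsto_nhds_unique ((hf i).tendsto (hg.mono fun F hF => hF.1.1) hgn hx) ?_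
      exact tendsto_const_nhds.congr' (hg.mono fun F hF => (hF.1.2.2.2 i).symm)
    · change Filter.Tendsto id _ _
      rw [tendsto_pi_nhds]
      intro ξ
      rw [tendsto_pi_nhds]
      intro η
      exact (hx ξ η).congr' (hg.mono fun F hF => congrFun (congrFun hF.2 ξ) η)
  obtain ⟨F, hF⟩ := hcomp.extremePoints_nonempty (hne.image Φ)
  rw [mem_extremePoints] at hF
  obtain ⟨⟨x, hxC, rfl⟩, hext⟩ := hF
  obtain ⟨hxM, hx0, hx1, hxf⟩ := hxC
  have hxs : IsSelfAdjoint x := .of_nonneg hx0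
  have hΦinj : ∀ y, Φ (x + y) = Φ x → y = 0 := by
    intro y hy
    ext η
    refine ext_inner_left ℂ fun ξ => ?_
    have := congrFun (congrFun hy ξ) η
    simpa [Φ, inner_add_right] using this
  -- If `h = x - x²` were nonzero, some `y = h z h ≠ 0` killed by all `f i` would put `x` at the
  -- midpoint of `x + y` and `x - y`, both in `C`.
  have hxx : x - x * x = 0 := by
    by_contra hne
    have hh0 : 0 ≤ x - x * x := by
      have e : x - x * x = x * (1 - x) * x + (1 - x) * x * (1 - x) := by noncomm_ring
      rw [e]
      exact add_nonneg (IsSelfAdjoint.conjugate_nonneg (sub_nonneg.2 hx1) hxs)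
        (IsSelfAdjoint.conjugate_nonneg hx0 ((IsSelfAdjoint.one _).sub hxs))
    have hhM : x - x * x ∈ M := sub_mem hxM (mul_mem hxM hxM)
    obtain ⟨z, hz, hzs, hz1, hy0, hyf⟩ := hM.exists_conjugate_eq_zero f hhM hh0 hne
    set y := (x - x * x) * z * (x - x * x) with hy
    have hyM : y ∈ M := mul_mem (mul_mem hhM hz) hhM
    have hyneg : (x - x * x) * (-z) * (x - x * x) = -y := by rw [hy]; noncomm_ring
    have hx' : (1 - x) - (1 - x) * (1 - x) = x - x * x := by noncomm_ring
    have h1x : 0 ≤ 1 - x := sub_nonneg.2 hx1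
    have h1x' : 1 - x ≤ 1 := sub_le_self _ hx0
    have hnz : ‖-z‖ ≤ 1 := by rwa [norm_neg]
    have b1 : y ≤ x := conjugate_sub_sq_le hx0 hx1 hzs hz1
    have b2 : -y ≤ x := hyneg ▸ conjugate_sub_sq_le hx0 hx1 hzs.neg hnz
    have b3 : y ≤ 1 - x := by
      have := conjugate_sub_sq_le h1x h1x' hzs hz1
      rwa [hx'] at this
    have b4 : -y ≤ 1 - x := by
      have := conjugate_sub_sq_le h1x h1x' hzs.neg hnz
      rwa [hx', hyneg] at this
    have hC1 : x + y ∈ C := by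
      refine ⟨add_mem hxM hyM, ?_, ?_, fun i => by rw [map_add, hyf, add_zero, hxf]⟩
      · have := sub_nonneg.2 b2
        rwa [sub_neg_eq_add] at this
      · have := le_sub_iff_add_le.1 b3
        rwa [add_comm] at this
    have hC2 : x - y ∈ C := by
      refine ⟨sub_mem hxM hyM, sub_nonneg.2 b1, ?_, fun i => by rw [map_sub, hyf, sub_zero, hxf]⟩
      have := le_sub_iff_add_le.1 b4
      rwa [add_comm, ← sub_eq_add_neg] at this
    have hseg : Φ x ∈ openSegment ℝ (Φ (x + y)) (Φ (x - y)) := by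
      refine ⟨1 / 2, 1 / 2, by norm_num, by norm_num, by norm_num, ?_⟩
      funext ξ η
      simp only [Φ, Pi.add_apply, Pi.smul_apply, add_apply, sub_apply, inner_add_right,
        inner_sub_right, Complex.real_smul]
      push_cast
      ring
    exact hy0 (hΦinj y (hext _ ⟨_, hC1, rfl⟩ _ ⟨_, hC2, rfl⟩ hseg).1)
  exact ⟨x, hxM, ⟨(sub_eq_zero.1 hxx).symm, hxs⟩, hxf⟩

end VonNeumannAlgebra

/-! ### Isometries on which several normal states are simultaneously diagonal -/

namespace VonNeumannAlgebra

variable {K : Type*} [NormedAddCommGroup K] [InnerProductSpace ℂ K] [CompleteSpace K]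
  {M : VonNeumannAlgebra K} {ι : Type*} [Finite ι]

/-- `v 0, …, v (k - 1)` are isometries of `M` (or zero, if the weight vanishes) with orthogonal
ranges, and every `ψ j` is diagonal, with weights `w`, on the resulting matrix units. -/
structure IsDiagonalFamily (M : VonNeumannAlgebra K) (ψ : ι → (K →L[ℂ] K) →ₗ[ℂ] ℂ) (w : ℕ → ℝ)
    (k : ℕ) (v : ℕ → K →L[ℂ] K) : Prop where
  mem : ∀ i < k, v i ∈ M
  star_mul : ∀ i < k, ∀ l < k, star (v i) * v l = if i = l ∧ w i ≠ 0 then 1 else 0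
  apply_eq : ∀ j, ∀ i < k, ∀ l < k, ψ j (v i * star (v l)) = if i = l then (w i : ℂ) else 0

theorem IsDiagonalFamily.congr {ψ : ι → (K →L[ℂ] K) →ₗ[ℂ] ℂ} {w : ℕ → ℝ} {k : ℕ}
    {v v' : ℕ → K →L[ℂ] K} (h : M.IsDiagonalFamily ψ w k v) (hv : ∀ i < k, v i = v' i) :
    M.IsDiagonalFamily ψ w k v' where
  mem i hi := hv i hi ▸ h.mem i hi
  star_mul i hi l hl := by rw [← hv i hi, ← hv l hl, h.star_mul i hi l hl]
  apply_eq j i hi l hl := by rw [← hv i hi, ← hv l hl, h.apply_eq j i hi l hl]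

/-- A unitary of `M` annihilated by finitely many normal functionals. -/
theorem IsTypeIIIFactor.exists_unitary_apply_eq_zero (hM : M.IsTypeIIIFactor) {κ : Type*}
    [Finite κ] (f : κ → (K →L[ℂ] K) →ₗ[ℂ] ℂ) (hf : ∀ i, M.BddWeakContinuousOn (f i)) :
    ∃ u ∈ M, star u = u ∧ u * u = 1 ∧ ∀ i, f i u = 0 := by
  -- With `s = 1 / 2` the symmetry `2p - 1` has the value `2 · f 1 / 2 - f 1 = 0`.
  obtain ⟨p, hp, hpp, hpf⟩ := hM.exists_projection_apply_eq f hf (s := 1 / 2) (by norm_num)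
    (by norm_num)
  have hp1 : p * p = p := hpp.isIdempotentElem
  have hp2 : star p = p := hpp.isSelfAdjoint
  refine ⟨p + p - 1, sub_mem (add_mem hp hp) (one_mem M), ?_, ?_, fun i => ?_⟩
  · rw [star_sub, star_add, hp2, star_one]
  · have e : (p + p - 1) * (p + p - 1) = 4 • (p * p) - 4 • p + 1 := by noncomm_ring
    rw [e, hp1, sub_self, zero_add]
  · rw [map_sub, map_add, hpf]
    push_cast
    ring

/-- All `ψ j` agree on the unused projection `1 - q`, with value `1 - W`. Lyapunov's theorem,
transported into this corner by an isometry `t`, yields a subprojection on which they all equal `w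
k`. An isometry `b` onto it may be replaced by `b u` with `u` unitary, which leaves the range
projection alone but removes the off-diagonal values. -/
theorem IsTypeIIIFactor.exists_isDiagonalFamily_succ (hM : M.IsTypeIIIFactor)
    (hsep : M.HasSeparablePredual) [Nonempty ι] {ψ : ι → (K →L[ℂ] K) →ₗ[ℂ] ℂ}
    (hψ : ∀ j, M.BddWeakContinuousOn (ψ j)) (hψ1 : ∀ j, ψ j 1 = 1) {w : ℕ → ℝ}
    (hw0 : ∀ k, 0 ≤ w k) (hw1 : ∀ k, ∑ i ∈ Finset.range k, w i ≤ 1) {k : ℕ}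
    {v : ℕ → K →L[ℂ] K} (hv : M.IsDiagonalFamily ψ w k v) :
    ∃ a, M.IsDiagonalFamily ψ w (k + 1) (Function.update v k a) := by
  suffices h : ∃ a ∈ M, star a * a = (if w k ≠ 0 then 1 else 0) ∧
      (∀ i < k, star a * v i = 0) ∧ (∀ j, ψ j (a * star a) = w k) ∧
      (∀ j, ∀ i < k, ψ j (a * star (v i)) = 0) ∧ ∀ j, ∀ i < k, ψ j (v i * star a) = 0 by
    obtain ⟨a, ha, haa, hav, hψa, hψ1, hψ2⟩ := h
    have hva : ∀ i < k, star (v i) * a = 0 := fun i hi => by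
      have := congrArg star (hav i hi)
      rwa [StarMul.star_mul, star_star, star_zero] at this
    refine ⟨a, ⟨fun i hi => ?_, fun i hi l hl => ?_, fun j i hi l hl => ?_⟩⟩
    · rcases Nat.lt_succ_iff_lt_or_eq.1 hi with hi | rfl
      · rw [Function.update_of_ne hi.ne]; exact hv.mem i hi
      · rw [Function.update_self]; exact ha
    · rcases Nat.lt_succ_iff_lt_or_eq.1 hi with hi | rfl <;>
      rcases Nat.lt_succ_iff_lt_or_eq.1 hl with hl | rfl
      · rw [Function.update_of_ne hi.ne, Function.update_of_ne hl.ne, hv.star_mul i hi l hl]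
      · rw [Function.update_of_ne hi.ne, Function.update_self, hva i hi]
        simp [hi.ne]
      · rw [Function.update_of_ne hl.ne, Function.update_self, hav l hl]
        simp [hl.ne']
      · rw [Function.update_self, haa]
        simp
    · rcases Nat.lt_succ_iff_lt_or_eq.1 hi with hi | rfl <;>
      rcases Nat.lt_succ_iff_lt_or_eq.1 hl with hl | rfl
      · rw [Function.update_of_ne hi.ne, Function.update_of_ne hl.ne, hv.apply_eq j i hi l hl]
      · rw [Function.update_of_ne hi.ne, Function.update_self, hψ2 j i hi]
        simp [hi.ne]
      · rw [Function.update_of_ne hl.ne, Function.update_self, hψ1 j l hl]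
        simp [hl.ne']
      · rw [Function.update_self, hψa]
        simp
  rcases eq_or_ne (w k) 0 with hwk | hwk
  · exact ⟨0, zero_mem M, by simp [hwk], by simp, by simp [hwk], by simp, by simp⟩
  have hwk0 : 0 < w k := lt_of_le_of_ne (hw0 k) hwk.symm
  have hvv : ∀ i < k, v i * (star (v i) * v i) = v i := by
    intro i hi
    have h1 := hv.star_mul i hi i hi
    rcases eq_or_ne (w i) 0 with hwi | hwi
    · have : v i = 0 := (CStarRing.star_mul_self_eq_zero_iff _).1 (by rw [h1]; simp [hwi])
      simp [this]
    · rw [h1]; simp [hwi]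
  set q := ∑ i ∈ Finset.range k, v i * star (v i) with hq
  have hqv : ∀ l < k, q * v l = v l := by
    intro l hl
    rw [hq, Finset.sum_mul, Finset.sum_eq_single_of_mem l (Finset.mem_range.2 hl)]
    · rw [mul_assoc, hvv l hl]
    · intro i hi hil
      rw [mul_assoc, hv.star_mul i (Finset.mem_range.1 hi) l hl, if_neg fun h => hil h.1, mul_zero]
  have hqM : q ∈ M := sum_mem fun i hi =>
    mul_mem (hv.mem i (Finset.mem_range.1 hi)) (star_mem (hv.mem i (Finset.mem_range.1 hi)))
  have hqq : IsStarProjection q := by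
    refine ⟨?_, ?_⟩
    · change q * q = q
      nth_rw 2 [hq]
      rw [Finset.mul_sum]
      exact Finset.sum_congr rfl fun i hi => by rw [← mul_assoc, hqv i (Finset.mem_range.1 hi)]
    · change star q = q
      rw [hq, star_sum]
      exact Finset.sum_congr rfl fun i _ => by rw [StarMul.star_mul, star_star]
  set W := ∑ i ∈ Finset.range k, w i with hW
  have hψq : ∀ j, ψ j (1 - q) = ((1 - W : ℝ) : ℂ) := by
    intro j
    rw [map_sub, hψ1, hq, map_sum, hW]
    push_cast
    congr 1
    exact Finset.sum_congr rfl fun i hi => by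
      rw [hv.apply_eq j i (Finset.mem_range.1 hi) i (Finset.mem_range.1 hi), if_pos rfl]
  have hWk : w k ≤ 1 - W := by
    have := hw1 (k + 1)
    rw [Finset.sum_range_succ] at this
    linarith
  have hWpos : 0 < 1 - W := hwk0.trans_le hWk
  obtain ⟨j₀⟩ := ‹Nonempty ι›
  have hg0 : 1 - q ≠ 0 := by
    intro h
    have := hψq j₀
    rw [h, map_zero] at this
    exact hWpos.ne (by exact_mod_cast this)
  obtain ⟨t, ht, htt, htq⟩ := hM.exists_isometry hsep (sub_mem (one_mem M) hqM) hqq.one_sub hg0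
  obtain ⟨p, hp, hpp, hpψ⟩ := hM.exists_projection_apply_eq
    -- The fraction is `w k / (1 - W)` because `ψ j (t t*) = 1 - W`.
    (fun j => ψ j ∘ₗ LinearMap.mulLeftRight ℂ (t, star t)) (fun j => (hψ j).mul_mul ht (star_mem ht))
    (s := w k / (1 - W)) (by positivity) ((div_le_one hWpos).2 hWk)
  have hp1 : p * p = p := hpp.isIdempotentElem
  have hp2 : star p = p := hpp.isSelfAdjoint
  have heψ : ∀ j, ψ j (t * p * star t) = w k := by
    intro j
    have h1 := hpψ j
    simp only [LinearMap.comp_apply, LinearMap.mulLeftRight_apply, mul_one, htq, hψq] at h1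
    rw [h1, ← Complex.ofReal_mul, div_mul_cancel₀ _ hWpos.ne']
  have hpt : star (p * star t) * (p * star t) = t * p * star t := by
    rw [StarMul.star_mul, star_star, hp2, mul_assoc, ← mul_assoc p, hp1, ← mul_assoc]
  have hee : IsStarProjection (t * p * star t) := by
    refine ⟨?_, ?_⟩
    · change t * p * star t * (t * p * star t) = _
      calc _ = t * p * (star t * t) * p * star t := by noncomm_ring
        _ = _ := by rw [htt, mul_one, mul_assoc t, hp1]
    · change star _ = _
      rw [StarMul.star_mul, StarMul.star_mul, star_star, hp2, mul_assoc]
  obtain ⟨b, hb, hbb, hbe⟩ := hM.exists_isometry hsep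
    (mul_mem (mul_mem ht hp) (star_mem ht)) hee (fun h => by
      have := heψ j₀
      rw [h, map_zero] at this
      exact hwk (by exact_mod_cast this.symm))
  have htv : ∀ i < k, star t * v i = 0 := by
    intro i hi
    have h1 : star t * (1 - q) = star t := by rw [← htq, ← mul_assoc, htt, one_mul]
    rw [← h1, mul_assoc, sub_mul, one_mul, hqv i hi, sub_self, mul_zero]
  have hbv : ∀ i < k, star b * v i = 0 := by
    intro i hi
    have h1 : star b * (t * p * star t) = star b := by rw [← hbe, ← mul_assoc, hbb, one_mul]
    rw [← h1, mul_assoc, mul_assoc (t * p), htv i hi, mul_zero, mul_zero]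
  -- The functionals to annihilate are `ψ j (b · v i*)` and `ψ j (v i · b*)`, finitely many at each
  -- stage.
  obtain ⟨u, hu, hus, huu, huf⟩ := hM.exists_unitary_apply_eq_zero
    (κ := (ι × Fin k) ⊕ (ι × Fin k))
    (Sum.elim (fun x => ψ x.1 ∘ₗ LinearMap.mulLeftRight ℂ (b, star (v x.2)))
      (fun x => ψ x.1 ∘ₗ LinearMap.mulLeftRight ℂ (v x.2, star b)))
    (by
      rintro (x | x)
      · exact (hψ x.1).mul_mul hb (star_mem (hv.mem _ x.2.2))
      · exact (hψ x.1).mul_mul (hv.mem _ x.2.2) (star_mem hb))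
  refine ⟨b * u, mul_mem hb hu, ?_, fun i hi => ?_, fun j => ?_, fun j i hi => ?_, fun j i hi => ?_⟩
  · rw [if_pos hwk, StarMul.star_mul, hus, mul_assoc, ← mul_assoc (star b), hbb, one_mul, huu]
  · rw [StarMul.star_mul, mul_assoc, hbv i hi, mul_zero]
  · rw [StarMul.star_mul, hus, mul_assoc, ← mul_assoc u, huu, one_mul, hbe, heψ]
  · have := huf (.inl (j, ⟨i, hi⟩))
    simpa using this
  · have := huf (.inr (j, ⟨i, hi⟩))
    rw [StarMul.star_mul, hus, ← mul_assoc]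
    simpa using this

theorem IsTypeIIIFactor.exists_diagonal_isometries (hM : M.IsTypeIIIFactor)
    (hsep : M.HasSeparablePredual) [Nonempty ι] {ψ : ι → (K →L[ℂ] K) →ₗ[ℂ] ℂ}
    (hψ : ∀ j, M.BddWeakContinuousOn (ψ j)) (hψ1 : ∀ j, ψ j 1 = 1) {κ : Type*} [Countable κ]
    [DecidableEq κ] {w : κ → ℝ} (hw0 : ∀ k, 0 < w k) (hw1 : HasSum w 1) :
    ∃ v : κ → K →L[ℂ] K, (∀ i, v i ∈ M) ∧ (∀ i l, star (v i) * v l = if i = l then 1 else 0) ∧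
      ∀ j i l, ψ j (v i * star (v l)) = if i = l then (w i : ℂ) else 0 := by
  obtain ⟨e, he⟩ := exists_injective_nat κ
  -- The recursion runs over `ℕ`, with weight zero off the image of `κ`; this is why vanishing
  -- weights with `v i = 0` are admitted. Entry `i` is frozen from stage `i + 1` on.
  set w' : ℕ → ℝ := Function.extend e w 0
  have hw'e : ∀ i, w' (e i) = w i := fun i => he.extend_apply _ _ _
  have hw'0 : ∀ k, 0 ≤ w' k := by
    intro k
    by_cases hk : ∃ i, e i = k
    · obtain ⟨i, rfl⟩ := hk
      rw [hw'e]; exact (hw0 i).le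
    · exact le_of_eq (Function.extend_apply' w (0 : ℕ → ℝ) k hk).symm
  have hw'1 : HasSum w' 1 := (hasSum_extend_zero he).2 hw1
  have hstep := fun (k : ℕ) (V : {v : ℕ → K →L[ℂ] K // M.IsDiagonalFamily ψ w' k v}) =>
    hM.exists_isDiagonalFamily_succ hsep hψ hψ1 hw'0
      (fun k => sum_le_hasSum _ (fun i _ => hw'0 i) hw'1) V.2
  choose a ha using hstep
  let V : ∀ k, {v : ℕ → K →L[ℂ] K // M.IsDiagonalFamily ψ w' k v} := fun k =>
    Nat.rec ⟨0, ⟨by simp, by simp, by simp⟩⟩ (fun k V => ⟨Function.update V.1 k (a k V), ha k V⟩) k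
  have hVsucc : ∀ k, (V (k + 1)).1 = Function.update (V k).1 k (a k (V k)) := fun k => rfl
  have hVstab : ∀ i d, (V (i + 1 + d)).1 i = (V (i + 1)).1 i := by
    intro i d
    induction d with
    | zero => rfl
    | succ d ih =>
      rw [← add_assoc, hVsucc, Function.update_of_ne (by omega), ih]
  have hfam : ∀ k, M.IsDiagonalFamily ψ w' k fun i => (V (i + 1)).1 i := by
    intro k
    refine (V k).2.congr fun i hi => ?_
    obtain ⟨d, rfl⟩ := Nat.exists_eq_add_of_le hi
    exact hVstab i d
  refine ⟨fun i => (V (e i + 1)).1 (e i), fun i => (hfam (e i + 1)).mem _ (Nat.lt_succ_self _),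
    fun i l => ?_, fun j i l => ?_⟩
  · rw [(hfam (e i + e l + 1)).star_mul (e i) (by omega) (e l) (by omega), hw'e]
    simp [he.eq_iff, (hw0 i).ne']
  · rw [(hfam (e i + e l + 1)).apply_eq j (e i) (by omega) (e l) (by omega), hw'e]
    simp [he.eq_iff]

end VonNeumannAlgebra

/-! ### Amplifications and the representation of `B(H)` defined by isometries -/

section Amplification

variable (I : Type*) {H : Type*} [NormedAddCommGroup H] [InnerProductSpace ℂ H] [CompleteSpace H]

theorem memℓp_apply (x : H →L[ℂ] H) (f : lp (fun _ : I => H) 2) :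
    Memℓp (fun i => x (f i)) 2 := by
  refine memℓp_gen ?_
  have hf : Summable fun i => ‖f i‖ ^ (2 : ENNReal).toReal :=
    (lp.memℓp f).summable (by norm_num)
  refine Summable.of_nonneg_of_le (fun i => by positivity) (fun i => ?_)
    (hf.mul_left (‖x‖ ^ (2 : ENNReal).toReal))
  rw [← Real.mul_rpow (norm_nonneg _) (norm_nonneg _)]
  exact Real.rpow_le_rpow (norm_nonneg _) (x.le_opNorm _) (by norm_num)

/-- The operator `1 ⊗ x` on the direct sum of copies of `H`. -/
noncomputable def amplify (x : H →L[ℂ] H) : lp (fun _ : I => H) 2 →L[ℂ] lp (fun _ : I => H) 2 :=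
  LinearMap.mkContinuous
    { toFun := fun f => ⟨fun i => x (f i), memℓp_apply I x f⟩
      map_add' := fun f g => by ext i; exact map_add x (f i) (g i)
      map_smul' := fun c f => by ext i; simp } ‖x‖ (fun f => by
        refine lp.norm_le_of_forall_sum_le (by norm_num) (by positivity) fun s => ?_
        have h1 := lp.sum_rpow_le_norm_rpow (p := 2) (by norm_num) f s
        rw [Real.mul_rpow (norm_nonneg _) (norm_nonneg _)]
        refine le_trans ?_ (mul_le_mul_of_nonneg_left h1 (by positivity))
        rw [Finset.mul_sum]
        refine Finset.sum_le_sum fun i _ => ?_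
        rw [← Real.mul_rpow (norm_nonneg _) (norm_nonneg _)]
        exact Real.rpow_le_rpow (norm_nonneg _) (x.le_opNorm _) (by norm_num))

@[simp]
theorem amplify_apply (x : H →L[ℂ] H) (f : lp (fun _ : I => H) 2) (i : I) :
    amplify I x f i = x (f i) := rfl

theorem amplify_single [DecidableEq I] (x : H →L[ℂ] H) (i : I) (h : H) :
    amplify I x (lp.single 2 i h) = lp.single 2 i (x h) := by
  ext j
  rw [amplify_apply, lp.single_apply, lp.single_apply]
  rcases eq_or_ne j i with rfl | hj
  · simp
  · simp [Pi.single_eq_of_ne hj]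

theorem amplify_star (x : H →L[ℂ] H) : amplify I (star x) = star (amplify I x) := by
  rw [ContinuousLinearMap.star_eq_adjoint (amplify I x), ContinuousLinearMap.eq_adjoint_iff]
  intro f g
  rw [lp.inner_eq_tsum, lp.inner_eq_tsum]
  refine tsum_congr fun i => ?_
  rw [amplify_apply, amplify_apply, ContinuousLinearMap.star_eq_adjoint,
    ContinuousLinearMap.adjoint_inner_left]

end Amplification

section Compression

variable {H K : Type*} [NormedAddCommGroup H] [InnerProductSpace ℂ H] [CompleteSpace H]
  [NormedAddCommGroup K] [InnerProductSpace ℂ K] [CompleteSpace K] {I : Type*}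

/-- The representation `x ↦ V (1 ⊗ x) V*` defined by an isometry `V`. -/
noncomputable def amplifyHom (V : lp (fun _ : I => H) 2 →ₗᵢ[ℂ] K) :
    (H →L[ℂ] H) →⋆ₙₐ[ℂ] (K →L[ℂ] K) where
  toFun x := V.toContinuousLinearMap ∘L amplify I x ∘L
    ContinuousLinearMap.adjoint V.toContinuousLinearMap
  map_smul' c x := by
    ext ξ
    simp only [ContinuousLinearMap.comp_apply, MonoidHom.id_apply, smul_apply]
    rw [← map_smul V.toContinuousLinearMap]
    rfl
  map_zero' := by
    ext ξ
    simp only [ContinuousLinearMap.comp_apply, zero_apply]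
    rw [← map_zero V.toContinuousLinearMap]
    congr 1
  map_add' x y := by
    ext ξ
    simp only [ContinuousLinearMap.comp_apply, add_apply, ← map_add]
    congr 1
  map_mul' x y := by
    ext ξ
    simp only [ContinuousLinearMap.comp_apply, mul_apply_eq_comp]
    have h := DFunLike.congr_fun (LinearIsometry.adjoint_comp_self V)
    simp only [ContinuousLinearMap.comp_apply] at h
    rw [h]
    congr 1
  map_star' x := by
    rw [amplify_star, ContinuousLinearMap.star_eq_adjoint, ContinuousLinearMap.star_eq_adjoint,
      ContinuousLinearMap.adjoint_comp, ContinuousLinearMap.adjoint_comp,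
      ContinuousLinearMap.adjoint_adjoint]
    rfl

theorem amplifyHom_apply_range (V : lp (fun _ : I => H) 2 →ₗᵢ[ℂ] K) (x : H →L[ℂ] H)
    (f : lp (fun _ : I => H) 2) : amplifyHom V x (V f) = V (amplify I x f) := by
  have h := DFunLike.congr_fun (LinearIsometry.adjoint_comp_self V) f
  exact congrArg (fun g => V (amplify I x g)) h

theorem amplifyHom_apply_mem_range (V : lp (fun _ : I => H) 2 →ₗᵢ[ℂ] K) (x : H →L[ℂ] H) (ξ : K) :
    ∃ f, amplifyHom V x ξ = V f := ⟨_, rfl⟩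

theorem tendsto_apply_of_mem_closure_span {ι : Type*} {l : Filter ι} {P : ι → K →L[ℂ] K}
    (hP : ∀ᶠ i in l, ‖P i‖ ≤ 1) {s : Set K}
    (hs : ∀ ζ ∈ s, Filter.Tendsto (fun i => P i ζ) l (𝓝 ζ)) {ζ : K}
    (hζ : ζ ∈ (Submodule.span ℂ s).topologicalClosure) :
    Filter.Tendsto (fun i => P i ζ) l (𝓝 ζ) := by
  have hspan : ∀ ζ ∈ Submodule.span ℂ s, Filter.Tendsto (fun i => P i ζ) l (𝓝 ζ) := by
    intro ζ hζ
    induction hζ using Submodule.span_induction with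
    | mem ζ h => exact hs ζ h
    | zero => simpa using tendsto_const_nhds
    | add ζ η _ _ h1 h2 => simpa using h1.add h2
    | smul c ζ _ h => simpa using h.const_smul c
  rw [Metric.tendsto_nhds]
  intro ε hε
  obtain ⟨ζ', hζ', hd⟩ := Metric.mem_closure_iff.1 hζ (ε / 3) (by positivity)
  filter_upwards [Metric.tendsto_nhds.1 (hspan ζ' hζ') (ε / 3) (by positivity), hP] with i hi hPi
  have h1 : dist (P i ζ) (P i ζ') ≤ dist ζ ζ' := by
    rw [dist_eq_norm, dist_eq_norm, ← map_sub]
    simpa using (P i).le_of_opNorm_le hPi (ζ - ζ')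
  calc dist (P i ζ) ζ ≤ dist (P i ζ) (P i ζ') + dist (P i ζ') ζ' + dist ζ' ζ :=
        dist_triangle4 _ _ _ _
    _ < ε := by rw [dist_comm ζ' ζ]; linarith

end Compression

namespace VonNeumannAlgebra

variable {H K : Type*} [NormedAddCommGroup H] [InnerProductSpace ℂ H] [CompleteSpace H]
  [NormedAddCommGroup K] [InnerProductSpace ℂ K] [CompleteSpace K]

/-- Isometries with orthogonal ranges, indexed by an orthonormal basis of `H`, define a
representation of `B(H)`. -/
theorem exists_hom_of_isometries {κ : Type*} [DecidableEq κ] (b : HilbertBasis κ ℂ H)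
    (v : κ → K →L[ℂ] K) (hv : ∀ i l, star (v i) * v l = if i = l then 1 else 0) :
    ∃ γ : (H →L[ℂ] H) →⋆ₙₐ[ℂ] (K →L[ℂ] K), ∀ x,
      (∀ F : Finset κ, ‖∑ i ∈ F, ∑ l ∈ F, ⟪b i, x (b l)⟫_ℂ • (v i * star (v l))‖ ≤ ‖γ x‖) ∧
      WeakTendsto (fun F : Finset κ => ∑ i ∈ F, ∑ l ∈ F, ⟪b i, x (b l)⟫_ℂ • (v i * star (v l)))
        Filter.atTop (γ x) := by
  classical
  obtain ⟨I, c, -⟩ := exists_hilbertBasis ℂ K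
  have hvin : ∀ i l ξ η, ⟪v i ξ, v l η⟫_ℂ = if i = l then ⟪ξ, η⟫_ℂ else 0 := by
    intro i l ξ η
    have h1 : ⟪v i ξ, v l η⟫_ℂ = ⟪ξ, (star (v i) * v l) η⟫_ℂ := by
      rw [mul_apply_eq_comp, ContinuousLinearMap.star_eq_adjoint,
        ContinuousLinearMap.adjoint_inner_right]
    rw [h1, hv]
    split_ifs <;> simp
  have hon : ∀ i : I, Orthonormal ℂ fun k => v k (c i) := by
    intro i
    rw [orthonormal_iff_ite]
    intro k l
    rw [hvin, orthonormal_iff_ite.1 c.orthonormal i i, if_pos rfl]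
  -- For each basis vector `c i` of `K`, the vectors `v k (c i)` span a copy of `H`. These copies
  -- are mutually orthogonal and assemble to an isometry `V` from the direct sum, so that `γ x = V
  -- (1 ⊗ x) V*`.
  let T : I → H →ₗᵢ[ℂ] K := fun i =>
    (hon i).orthogonalFamily.linearIsometry.comp b.repr.toLinearIsometry
  have hT : ∀ i h, HasSum (fun k => ⟪b k, h⟫_ℂ • v k (c i)) (T i h) := by
    intro i h
    have := (hon i).orthogonalFamily.hasSum_linearIsometry (b.repr h)
    simp only [HilbertBasis.repr_apply_apply, LinearIsometry.toSpanSingleton_apply] at this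
    exact this
  have hTb : ∀ i k, T i (b k) = v k (c i) := by
    intro i k
    refine (hT i (b k)).unique ?_
    have := hasSum_single (f := fun l => ⟪b l, b k⟫_ℂ • v l (c i)) k fun l hl => by
      rw [orthonormal_iff_ite.1 b.orthonormal l k, if_neg hl, zero_smul]
    rwa [orthonormal_iff_ite.1 b.orthonormal k k, if_pos rfl, one_smul] at this
  have horth : OrthogonalFamily ℂ (fun _ : I => H) T := by
    intro i j hij h g
    have h1 : ∀ k, ⟪v k (c i), T j g⟫_ℂ = 0 := by
      intro k
      refine ((hT j g).mapL (innerSL ℂ (v k (c i)))).unique ?_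
      convert hasSum_zero using 2 with l
      rw [innerSL_apply_apply, inner_smul_right, hvin,
        orthonormal_iff_ite.1 c.orthonormal i j, if_neg hij]
      simp
    have h2 : ⟪T j g, T i h⟫_ℂ = 0 := by
      refine ((hT i h).mapL (innerSL ℂ (T j g))).unique ?_
      convert hasSum_zero using 2 with l
      rw [innerSL_apply_apply, inner_smul_right, ← inner_conj_symm (T j g), h1]
      simp
    rw [← inner_conj_symm, h2, map_zero]
  let V := horth.linearIsometry
  have hVT : ∀ i h, V (lp.single 2 i h) = T i h := fun i h => horth.linearIsometry_apply_single h
  let γ := amplifyHom V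
  have hγT : ∀ x i h, γ x (T i h) = T i (x h) := fun x i h => by
    rw [← hVT, amplifyHom_apply_range, amplify_single, hVT]
  let s : Set K := {ζ | ∃ k ξ, ζ = v k ξ}
  let S : Submodule ℂ K := (Submodule.span ℂ s).topologicalClosure
  have hScl : IsClosed (S : Set K) := Submodule.isClosed_topologicalClosure _
  have : CompleteSpace S := hScl.completeSpace_coe
  have hvS : ∀ k ξ, v k ξ ∈ S := fun k ξ =>
    Submodule.le_topologicalClosure _ (Submodule.subset_span ⟨k, ξ, rfl⟩)
  have hTS : ∀ i h, T i h ∈ S := fun i h =>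
    hScl.mem_of_tendsto (hT i h) (Filter.Eventually.of_forall fun F =>
      Submodule.sum_mem _ fun k _ => Submodule.smul_mem _ _ (hvS k _))
  have hVS : ∀ f, V f ∈ S := fun f =>
    hScl.mem_of_tendsto (horth.hasSum_linearIsometry f) (Filter.Eventually.of_forall fun F =>
      Submodule.sum_mem _ fun i _ => hTS i _)
  have hγS : ∀ x ξ, γ x ξ ∈ S := fun x ξ => by
    obtain ⟨f, hf⟩ := amplifyHom_apply_mem_range V x ξ
    exact hf ▸ hVS f
  set Q := S.starProjection
  have hQQ : IsStarProjection Q := isStarProjection_starProjection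
  have hQof : ∀ y : K →L[ℂ] K, (∀ ξ, y ξ ∈ S) → Q * y = y := fun y hy =>
    ContinuousLinearMap.ext fun ξ => Submodule.starProjection_eq_self_iff.2 (hy ξ)
  have hγQ : ∀ x, γ x * Q = γ x := by
    intro x
    have := congrArg star (hQof (γ (star x)) (hγS _))
    rwa [star_mul, hQQ.isSelfAdjoint.star_eq, map_star, star_star] at this
  have hvQ : ∀ k, star (v k) * Q = star (v k) := by
    intro k
    have := congrArg star (hQof (v k) (hvS k))
    rwa [star_mul, hQQ.isSelfAdjoint.star_eq] at this
  have hcoef : ∀ x i l, star (v i) * γ x * v l = ⟪b i, x (b l)⟫_ℂ • (1 : K →L[ℂ] K) := by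
    intro x i l
    have h1 : ∀ m, (star (v i) * γ x * v l) (c m) = ⟪b i, x (b l)⟫_ℂ • c m := by
      intro m
      have h2 : (star (v i) * γ x * v l) (c m) = star (v i) (T m (x (b l))) := by
        rw [← hγT, hTb]
        rfl
      rw [h2]
      refine ((hT m (x (b l))).mapL (star (v i))).unique ?_
      have h3 : ∀ k, star (v i) (⟪b k, x (b l)⟫_ℂ • v k (c m)) =
          ⟪b k, x (b l)⟫_ℂ • (star (v i) * v k) (c m) := fun k => by rw [map_smul]; rfl
      simp only [h3, hv]
      have := hasSum_single (f := fun k => ⟪b k, x (b l)⟫_ℂ •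
        ((if i = k then 1 else 0 : K →L[ℂ] K)) (c m)) i fun k hk => by simp [hk.symm]
      simpa using this
    refine ContinuousLinearMap.ext_on (s := Set.range c) ?_ ?_
    · have := c.dense_span
      rw [Submodule.dense_iff_topologicalClosure_eq_top]
      exact this
    · rintro _ ⟨m, rfl⟩
      rw [h1]
      rfl
  let P : Finset κ → K →L[ℂ] K := fun F => ∑ k ∈ F, v k * star (v k)
  have hPv : ∀ F, ∀ k ∈ F, P F * v k = v k := by
    intro F k hk
    rw [Finset.sum_mul, Finset.sum_eq_single_of_mem k hk]
    · rw [mul_assoc, hv, if_pos rfl, mul_one]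
    · intro l _ hl
      rw [mul_assoc, hv, if_neg hl, mul_zero]
  have hPP : ∀ F, IsStarProjection (P F) := by
    intro F
    refine ⟨?_, ?_⟩
    · change P F * (∑ k ∈ F, v k * star (v k)) = _
      rw [Finset.mul_sum]
      exact Finset.sum_congr rfl fun k hk => by rw [← mul_assoc, hPv F k hk]
    · change star (∑ k ∈ F, v k * star (v k)) = _
      rw [star_sum]
      exact Finset.sum_congr rfl fun k _ => by rw [star_mul, star_star]
  have hPnorm : ∀ F, ‖P F‖ ≤ 1 := fun F => IsStarProjection.norm_le _ (hPP F)
  have hPQ : ∀ F, P F * Q = P F := fun F => by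
    rw [Finset.sum_mul]
    exact Finset.sum_congr rfl fun k _ => by rw [mul_assoc, hvQ]
  have hPlim : ∀ ξ, Filter.Tendsto (fun F => P F ξ) Filter.atTop (𝓝 (Q ξ)) := by
    intro ξ
    have h1 := tendsto_apply_of_mem_closure_span (l := Filter.atTop) (.of_forall hPnorm) (s := s) (by
      rintro _ ⟨k, ξ, rfl⟩
      refine tendsto_const_nhds.congr' ?_
      filter_upwards [Filter.eventually_ge_atTop {k}] with F hF
      exact (DFunLike.congr_fun (hPv F k (Finset.singleton_subset_iff.1 hF)) ξ).symm)
      (Submodule.starProjection_apply_mem S ξ)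
    exact h1.congr fun F => DFunLike.congr_fun (hPQ F) ξ
  -- The finite sums are compressions of `γ x` by `P F`. As `P F → Q` strongly and `γ x = Q (γ x)
  -- Q`, both the norm bound and the weak limit follow.
  have hform : ∀ x F, ∑ i ∈ F, ∑ l ∈ F, ⟪b i, x (b l)⟫_ℂ • (v i * star (v l)) =
      P F * γ x * P F := by
    intro x F
    simp only [P]
    rw [Finset.sum_mul, Finset.sum_mul]
    refine Finset.sum_congr rfl fun i _ => ?_
    rw [Finset.mul_sum]
    refine Finset.sum_congr rfl fun l _ => ?_
    calc _ = v i * (⟪b i, x (b l)⟫_ℂ • (1 : K →L[ℂ] K)) * star (v l) := by simp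
      _ = _ := by rw [← hcoef]; noncomm_ring
  refine ⟨γ, fun x => ⟨fun F => ?_, ?_⟩⟩
  · rw [hform]
    calc ‖P F * γ x * P F‖ ≤ ‖P F‖ * ‖γ x‖ * ‖P F‖ :=
          (norm_mul_le _ _).trans (by gcongr; exact norm_mul_le _ _)
      _ ≤ 1 * ‖γ x‖ * 1 := by gcongr <;> exact hPnorm F
      _ = _ := by ring
  · intro ξ η
    have h1 := (hPlim ξ).inner (𝕜 := ℂ) (((γ x).continuous.tendsto _).comp (hPlim η))
    have h2 : ⟪Q ξ, γ x (Q η)⟫_ℂ = ⟪ξ, γ x η⟫_ℂ := by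
      have e1 : γ x (Q η) = γ x η := DFunLike.congr_fun (hγQ x) η
      have e2 : Q (γ x η) = γ x η := DFunLike.congr_fun (hQof _ (hγS x)) η
      rw [e1, Submodule.inner_starProjection_left_eq_right, e2]
    rw [h2] at h1
    refine h1.congr fun F => ?_
    dsimp only
    rw [hform, mul_apply_eq_comp, mul_apply_eq_comp,
      ← ContinuousLinearMap.adjoint_inner_left, ← ContinuousLinearMap.star_eq_adjoint,
      (hPP F).isSelfAdjoint.star_eq]
    rfl

end VonNeumannAlgebra

/-! ### Normal functionals, normal states and the embedding into `M` -/

namespace VonNeumannAlgebra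

variable {K : Type*} [NormedAddCommGroup K] [InnerProductSpace ℂ K] [CompleteSpace K]
  {M : VonNeumannAlgebra K}

/-- A norm bound dominates the defining series termwise, so weak convergence passes through the sum.
-/
theorem tendsto_sigmaWeak {l : Filter (K →L[ℂ] K)} {x : K →L[ℂ] K} {R : ℝ}
    (hR : ∀ᶠ y in l, ‖y‖ ≤ R) (h : WeakTendsto id l x) : l ≤ @nhds _ (sigmaWeakTopology K) x := by
  simp only [nhds_iInf, nhds_induced, le_iInf_iff]
  intro ξ η hξ hη
  rw [← Filter.tendsto_iff_comap]
  have hsum : Summable fun n => ‖ξ n‖ * (|R| * ‖η n‖) := by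
    refine Summable.of_nonneg_of_le (fun n => by positivity) (fun n => ?_)
      ((hξ.add hη).mul_left |R|)
    nlinarith [mul_nonneg (abs_nonneg R) (sq_nonneg (‖ξ n‖ - ‖η n‖)),
      mul_nonneg (abs_nonneg R) (mul_nonneg (norm_nonneg (ξ n)) (norm_nonneg (η n)))]
  refine tendsto_tsum_of_dominated_convergence hsum (fun n => h (ξ n) (η n)) ?_
  filter_upwards [hR] with y hy n
  refine (norm_inner_le_norm _ _).trans ?_
  gcongr
  exact (y.le_of_opNorm_le hy _).trans (by gcongr; exact le_abs_self R)

/-- The extension is purely algebraic and arbitrary outside `M`; continuity is only tested along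
filters living in `M`. -/
theorem IsNormal.exists_extension {ψ : M.toStarSubalgebra →ₗ[ℂ] ℂ} (h : M.IsNormal ψ) :
    ∃ f : (K →L[ℂ] K) →ₗ[ℂ] ℂ, M.BddWeakContinuousOn f ∧ ∀ x : M.toStarSubalgebra, f x = ψ x := by
  classical
  obtain ⟨f, hf⟩ := LinearMap.exists_extend
    (p := Subalgebra.toSubmodule M.toStarSubalgebra.toSubalgebra) ψ
  have hfψ : ∀ x : M.toStarSubalgebra, f x = ψ x := fun x => DFunLike.congr_fun hf x
  refine ⟨f, fun l x R hM hR hx => ?_, hfψ⟩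
  rcases l.eq_or_neBot with rfl | hl
  · exact Filter.tendsto_bot
  have hxM : x ∈ M := hx.mem hM
  let g : (K →L[ℂ] K) → M.toStarSubalgebra := fun y => if hy : y ∈ M then ⟨y, hy⟩ else 0
  have hg : ∀ᶠ y in l, (g y : K →L[ℂ] K) = y := hM.mono fun y hy => by simp [g, hy]
  have h1 : Filter.Tendsto g l (@nhds _ (TopologicalSpace.induced Subtype.val
      (sigmaWeakTopology K)) (⟨x, hxM⟩ : M.toStarSubalgebra)) := by
    rw [@nhds_induced _ _ (sigmaWeakTopology K) Subtype.val, Filter.tendsto_comap_iff]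
    refine Filter.Tendsto.congr' (hg.mono fun y hy => hy.symm) (f₁ := id) ?_
    exact tendsto_sigmaWeak hR hx
  have h2 : Filter.Tendsto ψ (@nhds _ (TopologicalSpace.induced Subtype.val
      (sigmaWeakTopology K)) (⟨x, hxM⟩ : M.toStarSubalgebra)) (𝓝 (ψ ⟨x, hxM⟩)) :=
    (@Continuous.tendsto _ _ (TopologicalSpace.induced Subtype.val (sigmaWeakTopology K))
      _ _ h _)
  have h3 := h2.comp h1
  rw [← hfψ] at h3
  exact h3.congr' (hg.mono fun y hy => by rw [Function.comp_apply, ← hfψ, hy])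

/-- A positive functional attains its norm at `1`: rotate `a` so that `ψ` of it is nonnegative. Then
only the real part contributes, and it is at most `1` in the operator order. -/
theorem isState_apply_one {ψ : M.toStarSubalgebra →ₚ[ℂ] ℂ} (h : IsState ψ) : ψ 1 = 1 := by
  have hpos : ∀ z : M.toStarSubalgebra, (0 : K →L[ℂ] K) ≤ z → 0 ≤ ψ z := fun z hz =>
    ψ.map_nonneg hz
  have h1 : 0 ≤ ψ 1 := hpos 1 zero_le_one
  have hsa : ∀ z : M.toStarSubalgebra, IsSelfAdjoint z → ‖z‖ ≤ 1 →
      (ψ z).im = 0 ∧ (ψ z).re ≤ (ψ 1).re := by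
    intro z hz hz1
    have hz' : IsSelfAdjoint (z : K →L[ℂ] K) := congrArg Subtype.val hz.star_eq
    have h2 := hpos (1 - z) (sub_nonneg.2 (hz'.le_one_of_norm_le hz1))
    rw [map_sub] at h2
    have h3 := Complex.nonneg_iff.1 h2
    have h4 := Complex.nonneg_iff.1 h1
    rw [Complex.sub_re, Complex.sub_im] at h3
    exact ⟨by linarith [h3.2, h4.2], by linarith [h3.1]⟩
  have hbound : ∀ a : M.toStarSubalgebra, ‖a‖ ≤ 1 → ‖ψ a‖ ≤ (ψ 1).re := by
    intro a ha
    obtain ⟨c, hc, hca⟩ : ∃ c : ℂ, ‖c‖ = 1 ∧ c * ψ a = ‖ψ a‖ := by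
      rcases eq_or_ne (ψ a) 0 with h0 | h0
      · exact ⟨1, by simp, by simp [h0]⟩
      · refine ⟨‖ψ a‖ / ψ a, ?_, div_mul_cancel₀ _ h0⟩
        rw [norm_div, Complex.norm_real, norm_norm, div_self (norm_ne_zero_iff.2 h0)]
    set b := c • a with hb
    have hb1 : ‖b‖ ≤ 1 := by rw [hb, norm_smul, hc, one_mul]; exact ha
    have hsb : ‖star b‖ = ‖b‖ := norm_star (b : K →L[ℂ] K)
    have hx := hsa ((1 / 2 : ℂ) • (b + star b)) (by
      change star _ = _
      rw [star_smul, star_add, star_star, add_comm (star b)]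
      simp) (by
      have h2 := norm_add_le b (star b)
      have h3 : ‖(1 / 2 : ℂ)‖ = 1 / 2 := by norm_num
      rw [norm_smul, h3]
      linarith)
    have hy := hsa ((-Complex.I / 2 : ℂ) • (b - star b)) (by
      change star _ = _
      rw [star_smul, star_sub, star_star, ← neg_sub b, smul_neg, ← neg_smul]
      congr 1
      simp [neg_div]) (by
      have h2 := norm_sub_le b (star b)
      have h3 : ‖(-Complex.I / 2 : ℂ)‖ = 1 / 2 := by simp
      rw [norm_smul, h3]
      linarith)
    have hdec : b = (1 / 2 : ℂ) • (b + star b) + Complex.I • ((-Complex.I / 2 : ℂ) •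
        (b - star b)) := by
      rw [smul_smul, show Complex.I * (-Complex.I / 2) = 1 / 2 by
        rw [← mul_div_assoc, mul_neg, Complex.I_mul_I, neg_neg], ← smul_add]
      rw [show b + star b + (b - star b) = (2 : ℂ) • b by rw [two_smul]; abel, smul_smul]
      norm_num
    have hψb : ψ b = ‖ψ a‖ := by rw [hb, map_smul, smul_eq_mul, hca]
    have h5 := congrArg ψ hdec
    rw [hψb, map_add, map_smul ψ Complex.I, smul_eq_mul] at h5
    have h6 := congrArg Complex.re h5
    rw [Complex.add_re, Complex.mul_re, Complex.I_re, Complex.I_im, hy.1] at h6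
    simp only [Complex.ofReal_re, zero_mul, mul_zero, sub_zero, add_zero] at h6
    rw [h6]
    exact hx.2
  have hle : 1 ≤ (ψ 1).re := h.2 (by
    rintro _ ⟨a, ha, rfl⟩
    exact hbound a (by simpa using ha))
  have hge : ‖ψ 1‖ ≤ 1 := h.1 ⟨1, by
    rw [mem_closedBall_zero_iff]
    exact IsStarProjection.norm_le (1 : K →L[ℂ] K) (IsStarProjection.one _), rfl⟩
  have him := (Complex.nonneg_iff.1 h1).2
  have hre := (Complex.re_le_norm (ψ 1)).trans hge
  exact Complex.ext (by rw [Complex.one_re]; linarith) (by rw [Complex.one_im]; exact him.symm)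

theorem bddWeakContinuousOn_vector (ξ : K) :
    ∃ f : (K →L[ℂ] K) →ₗ[ℂ] ℂ, M.BddWeakContinuousOn f ∧ ∀ x, f x = ⟪ξ, x ξ⟫_ℂ :=
  ⟨{ toFun := fun x => ⟪ξ, x ξ⟫_ℂ
     map_add' := fun x y => by simp
     map_smul' := fun c x => by simp }, fun _ _ _ _ _ h => h ξ ξ, fun _ => rfl⟩

end VonNeumannAlgebra

open VonNeumannAlgebra in
/-- A faithful functional which is diagonal, with positive weights, in some representation on a
separable Hilbert space embeds in all type III factors with separable predual. -/
theorem embedsInTypeIIIFactors_of_diagonal {A : Type u} [NonUnitalCStarAlgebra A] [PartialOrder A]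
    [StarOrderedRing A] {φ : A →ₚ[ℂ] ℂ} (hφ : IsFaithful φ) {H : Type*} [NormedAddCommGroup H]
    [InnerProductSpace ℂ H] [CompleteSpace H] (ρ : A →⋆ₙₐ[ℂ] (H →L[ℂ] H)) {κ : Type*} [Countable κ]
    (b : HilbertBasis κ ℂ H) {w : κ → ℝ} (hw0 : ∀ k, 0 < w k) (hw1 : HasSum w 1)
    (hρ : ∀ a, HasSum (fun k => (w k : ℂ) * ⟪b k, ρ a (b k)⟫_ℂ) (φ a)) :
    EmbedsInTypeIIIFactors.{u, v} φ := by
  classical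
  intro K _ _ _ M hM hsep n ψ hψs hψn
  choose f hf hfψ using fun j => (hψn j : M.IsNormal (ψ j).toLinearMap).exists_extension
  -- An auxiliary vector state joins the given ones, so that the family is nonempty and injectivity
  -- can be read off even when `n = 0`.
  obtain ⟨ζ, hζ⟩ := @exists_ne K hM.1.1 0
  obtain ⟨f₀, hf₀, hf₀ζ⟩ := bddWeakContinuousOn_vector (M := M) ((‖ζ‖⁻¹ : ℂ) • ζ)
  have hf₀1 : f₀ 1 = 1 := by
    rw [hf₀ζ, one_apply_eq_self, inner_self_eq_norm_sq_to_K, norm_smul, norm_inv,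
      Complex.norm_real, norm_norm, inv_mul_cancel₀ (norm_ne_zero_iff.2 hζ)]
    simp
  let g : Option (Fin n) → (K →L[ℂ] K) →ₗ[ℂ] ℂ := fun o => o.elim f₀ f
  have hg : ∀ o, M.BddWeakContinuousOn (g o) := by
    rintro (_ | j)
    exacts [hf₀, hf j]
  have hg1 : ∀ o, g o 1 = 1 := by
    rintro (_ | j)
    · exact hf₀1
    · exact (hfψ j 1).trans (isState_apply_one (hψs j))
  obtain ⟨v, hvM, hvv, hvg⟩ := hM.exists_diagonal_isometries hsep hg hg1 hw0 hw1
  obtain ⟨γ, hγ⟩ := exists_hom_of_isometries b v hvv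
  have hmem : ∀ (x : H →L[ℂ] H) (F : Finset κ),
      ∑ i ∈ F, ∑ l ∈ F, ⟪b i, x (b l)⟫_ℂ • (v i * star (v l)) ∈ M := fun x F =>
    sum_mem fun i _ => sum_mem fun l _ => smul_mem (mul_mem (hvM i) (star_mem (hvM l))) _
  have hγM : ∀ x, γ x ∈ M := fun x => (hγ x).2.mem (Filter.Eventually.of_forall (hmem x))
  have hgγ : ∀ o a, g o (γ (ρ a)) = φ a := by
    intro o a
    have h1 := (hg o).tendsto (Filter.Eventually.of_forall (hmem (ρ a)))
      (Filter.Eventually.of_forall (hγ (ρ a)).1) (hγ (ρ a)).2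
    refine tendsto_nhds_unique h1 ?_
    refine (hρ a).congr fun F => ?_
    rw [map_sum]
    refine Finset.sum_congr rfl fun i hi => ?_
    rw [map_sum, Finset.sum_eq_single_of_mem i hi]
    · rw [map_smul, hvg, if_pos rfl, smul_eq_mul, mul_comm]
    · intro l _ hl
      rw [map_smul, hvg, if_neg hl.symm, smul_zero]
  let γ' : A →⋆ₙₐ[ℂ] M.toStarSubalgebra :=
    { toFun := fun a => ⟨γ (ρ a), hγM _⟩
      map_smul' := fun c a => Subtype.ext (by simp)
      map_zero' := Subtype.ext (by simp)
      map_add' := fun a a' => Subtype.ext (by simp)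
      map_mul' := fun a a' => Subtype.ext (by simp)
      map_star' := fun a => Subtype.ext (by simp [map_star]) }
  refine ⟨γ', fun a a' haa' => ?_, fun j a => ?_⟩
  · have h1 : γ (ρ (a - a')) = 0 := by
      rw [map_sub, map_sub, sub_eq_zero]
      exact congrArg Subtype.val haa'
    refine sub_eq_zero.1 (hφ _ ?_)
    rw [← hgγ none, map_mul, map_mul, h1, mul_zero, map_zero]
  · rw [← hgγ (some j) a]
    exact (hfψ j (γ' a)).symm

/-! ### The cyclic vector of a state without a unit -/

section GNSVector

variable {A : Type u} [NonUnitalCStarAlgebra A] [PartialOrder A] [StarOrderedRing A]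
  {φ : A →ₚ[ℂ] ℂ}

theorem IsState.norm_apply_le (hφ : IsState φ) (a : A) : ‖φ a‖ ≤ ‖a‖ := by
  rcases eq_or_ne a 0 with rfl | ha
  · simp
  have hn : 0 < ‖a‖ := norm_pos_iff.2 ha
  have h : ‖φ (((‖a‖⁻¹ : ℝ) : ℂ) • a)‖ ≤ 1 := by
    refine hφ.1 ⟨_, ?_, rfl⟩
    rw [mem_closedBall_zero_iff, norm_smul, Complex.norm_real, norm_inv, norm_norm,
      inv_mul_cancel₀ hn.ne']
  rw [map_smul, norm_smul, Complex.norm_real, norm_inv, norm_norm, inv_mul_le_iff₀ hn] at h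
  simpa using h

theorem IsState.continuous (hφ : IsState φ) : Continuous φ :=
  AddMonoidHomClass.continuous_of_bound φ 1 fun a => by simpa using hφ.norm_apply_le a

theorem IsState.norm_toPreGNS_le (hφ : IsState φ) (a : A) : ‖φ.toPreGNS a‖ ≤ ‖a‖ := by
  have h : ((‖φ.toPreGNS a‖ ^ 2 : ℝ) : ℂ) = φ (star a * a) := by
    push_cast
    simpa using φ.preGNS_norm_sq (φ.toPreGNS a)
  have h1 : ‖φ.toPreGNS a‖ ^ 2 = ‖φ (star a * a)‖ := by
    rw [← h, Complex.norm_real, Real.norm_of_nonneg (by positivity)]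
  have h2 := hφ.norm_apply_le (star a * a)
  rw [CStarRing.norm_star_mul_self, ← h1, ← sq] at h2
  exact (sq_le_sq₀ (norm_nonneg _) (norm_nonneg _)).1 h2

/-- Cauchy–Schwarz for `φ (e a)` along an approximate unit of contractions `e`. Thus `φ` descends to
a bounded functional on the GNS space, whose Riesz vector is `Ω`. -/
theorem IsState.norm_apply_le_norm_toPreGNS (hφ : IsState φ) (a : A) :
    ‖φ a‖ ≤ ‖φ.toPreGNS a‖ := by
  have hu := CStarAlgebra.increasingApproximateUnit A
  have := hu.neBot
  refine le_of_tendsto ((hφ.continuous.tendsto a).comp (hu.tendsto_mul_right a)).norm ?_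
  filter_upwards [hu.eventually_nonneg, hu.eventually_norm] with e he0 he1
  have h : φ (e * a) = ⟪φ.toPreGNS e, φ.toPreGNS a⟫_ℂ := by
    rw [φ.preGNS_inner_def]
    simp [he0.isSelfAdjoint.star_eq]
  rw [Function.comp_apply, h]
  refine (norm_inner_le_norm _ _).trans ?_
  exact mul_le_of_le_one_left (norm_nonneg _) ((hφ.norm_toPreGNS_le e).trans he1)

/-- The unit cyclic vector of the GNS representation of a state. -/
theorem IsState.exists_isGNSTriple (hφ : IsState φ) :
    ∃ Ω : φ.GNS, IsGNSTriple φ φ.gnsNonUnitalStarAlgHom Ω ∧ ‖Ω‖ = 1 := by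
  let f₀ : φ.PreGNS →L[ℂ] ℂ := LinearMap.mkContinuous
    (φ.toLinearMap ∘ₗ φ.ofPreGNS.toLinearMap) 1 (fun x => by
      simpa using hφ.norm_apply_le_norm_toPreGNS (φ.ofPreGNS x))
  let f : φ.GNS →L[ℂ] ℂ := f₀.extend (UniformSpace.Completion.toComplL)
  have hf : ∀ a : φ.PreGNS, f (a : φ.GNS) = φ (φ.ofPreGNS a) := fun a =>
    f₀.extend_eq (e := UniformSpace.Completion.toComplL)
      (UniformSpace.Completion.denseRange_coe)
      (UniformSpace.Completion.isUniformInducing_coe _) a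
  have hfn : ‖f‖ ≤ 1 := by
    refine f.opNorm_le_bound zero_le_one fun x => ?_
    induction x using UniformSpace.Completion.induction_on with
    | hp => exact isClosed_le (by fun_prop) (by fun_prop)
    | ih x =>
      rw [hf, UniformSpace.Completion.norm_coe, one_mul]
      exact hφ.norm_apply_le_norm_toPreGNS (φ.ofPreGNS x)
  let Ω : φ.GNS := (InnerProductSpace.toDual ℂ φ.GNS).symm f
  have hΩ : ∀ ξ, ⟪Ω, ξ⟫_ℂ = f ξ := fun ξ => InnerProductSpace.toDual_symm_apply
  have hπ : ∀ a, φ.gnsNonUnitalStarAlgHom a Ω = (φ.toPreGNS a : φ.GNS) := by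
    intro a
    refine ext_inner_right ℂ fun ξ => ?_
    induction ξ using UniformSpace.Completion.induction_on with
    | hp => exact isClosed_eq (by fun_prop) (by fun_prop)
    | ih x =>
      rw [← ContinuousLinearMap.adjoint_inner_right, ← ContinuousLinearMap.star_eq_adjoint,
        ← map_star, hΩ, φ.gnsNonUnitalStarAlgHom_apply_coe, hf,
        UniformSpace.Completion.inner_coe, φ.preGNS_inner_def]
      simp
  have hin : ∀ a, ⟪Ω, φ.gnsNonUnitalStarAlgHom a Ω⟫_ℂ = φ a := by
    intro a
    rw [hπ, hΩ, hf]
    simp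
  refine ⟨Ω, ⟨?_, hin⟩, le_antisymm ?_ ?_⟩
  · have : Set.range (fun a => φ.gnsNonUnitalStarAlgHom a Ω)
        = Set.range ((↑) : φ.PreGNS → φ.GNS) := by
      ext ξ
      constructor
      · rintro ⟨a, rfl⟩
        exact ⟨_, (hπ a).symm⟩
      · rintro ⟨x, rfl⟩
        exact ⟨φ.ofPreGNS x, by simp only [hπ]; simp⟩
    rw [this]
    exact UniformSpace.Completion.denseRange_coe
  · simpa [Ω] using hfn
  -- On the unit ball `|φ a| = |⟨Ω, π a Ω⟩| ≤ ‖Ω‖²`, and the supremum of the left side is `1`.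
  · have h : (1 : ℝ) ≤ ‖Ω‖ ^ 2 := by
      refine hφ.2 ?_
      rintro _ ⟨a, ha, rfl⟩
      rw [mem_closedBall_zero_iff] at ha
      change ‖φ a‖ ≤ _
      rw [← hin a]
      calc _ ≤ ‖Ω‖ * (‖φ.gnsNonUnitalStarAlgHom a‖ * ‖Ω‖) :=
            (norm_inner_le_norm _ _).trans
              (mul_le_mul_of_nonneg_left (ContinuousLinearMap.le_opNorm _ _) (norm_nonneg _))
        _ ≤ ‖Ω‖ * (1 * ‖Ω‖) := by
            gcongr
            exact (NonUnitalStarAlgHom.norm_apply_le _ a).trans ha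
        _ = ‖Ω‖ ^ 2 := by ring
    nlinarith [norm_nonneg Ω]

end GNSVector

/-! ### Density of the algebra in its bicommutant -/

section Density

variable {A : Type*} [NonUnitalCStarAlgebra A]
  {H : Type*} [NormedAddCommGroup H] [InnerProductSpace ℂ H] [CompleteSpace H]
  {π : A →⋆ₙₐ[ℂ] (H →L[ℂ] H)} {x : H →L[ℂ] H}

/-- A dense range of vectors `π a Ω` excludes nonzero vectors that are killed by `π`. -/
theorem nondegenerate_of_cyclic {Ω : H} (h : Dense (Set.range fun a => π a Ω)) {ξ : H}
    (hξ : ∀ a, π a ξ = 0) : ξ = 0 := by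
  refine h.eq_zero_of_inner_left ℂ ?_
  rintro _ ⟨a, rfl⟩
  change ⟪ξ, π a Ω⟫_ℂ = 0
  rw [← ContinuousLinearMap.adjoint_inner_left, ← ContinuousLinearMap.star_eq_adjoint, ← map_star,
    hξ, inner_zero_left]

/-- Simultaneous approximation of an element of the bicommutant on finitely many vectors. -/
theorem amplify_apply_mem_closure {I : Type*} [Fintype I]
    (hnd : ∀ ξ, (∀ a, π a ξ = 0) → ξ = 0)
    (hx : x ∈ Set.centralizer (Set.centralizer (Set.range π))) (ζ : lp (fun _ : I => H) 2) :
    amplify I x ζ ∈ closure (Set.range fun a => amplify I (π a) ζ) := by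
  classical
  let L : A →ₗ[ℂ] lp (fun _ : I => H) 2 :=
    { toFun := fun a => amplify I (π a) ζ
      map_add' := fun a b => by ext i; simp
      map_smul' := fun c a => by ext i; simp }
  let D := (LinearMap.range L).topologicalClosure
  have hD : IsClosed (D : Set (lp (fun _ : I => H) 2)) :=
    (LinearMap.range L).isClosed_topologicalClosure
  have : CompleteSpace D := hD.completeSpace_coe
  let P := D.starProjection
  have hinv : ∀ c, ∀ f ∈ D, amplify I (π c) f ∈ D := by
    intro c f hf
    refine (LinearMap.range L).topologicalClosure_minimal (t := D.comap (amplify I (π c)).toLinearMap)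
      ?_ ?_ hf
    · rintro _ ⟨a, rfl⟩
      refine (LinearMap.range L).le_topologicalClosure ⟨c * a, ?_⟩
      ext i
      simp [L]
    · exact hD.preimage (amplify I (π c)).continuous
  have hcomm : ∀ c, P * amplify I (π c) = amplify I (π c) * P := by
    have h1 : ∀ c, P * (amplify I (π c) * P) = amplify I (π c) * P := fun c => by
      ext1 f
      exact Submodule.starProjection_eq_self_iff.2 (hinv c _ (D.starProjection_apply_mem f))
    intro c
    have h2 := congrArg star (h1 (star c))
    have hP : star P = P := isSelfAdjoint_starProjection D
    rw [star_mul, star_mul, map_star, amplify_star, star_star, hP] at h2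
    rw [← h2, mul_assoc, h1 c]
  -- The matrix entries of `P` lie in the commutant of `π`, hence commute with `x`; so `P` commutes
  -- with `1 ⊗ x`.
  have hent : ∀ i j, (lp.evalCLM ℂ (fun _ : I => H) 2 i ∘L P ∘L
      lp.singleContinuousLinearMap ℂ (fun _ : I => H) 2 j) ∈ Set.centralizer (Set.range π) := by
    rintro i j _ ⟨c, rfl⟩
    ext1 h
    have := congrArg (fun T => T (lp.single 2 j h) i) (hcomm c)
    simp only [mul_apply_eq_comp, amplify_single, amplify_apply] at this
    exact this.symm
  have hxP : ∀ f, P (amplify I x f) = amplify I x (P f) := by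
    intro f
    have hsum : f = ∑ j, lp.single 2 j (f j) := by
      ext i
      have h := congrFun (lp.coeFn_sum (fun j => lp.single 2 j (f j)) Finset.univ) i
      rw [Finset.sum_apply] at h
      rw [h, Finset.sum_eq_single i]
      · simp [lp.single_apply]
      · intro j _ hj
        simp [lp.single_apply, Pi.single_eq_of_ne hj.symm]
      · simp
    rw [hsum]
    simp only [map_sum, amplify_single]
    refine Finset.sum_congr rfl fun j _ => ?_
    ext i
    have := congrArg (fun T => T (f j)) (hx _ (hent i j))
    simp only [mul_apply_eq_comp] at this
    exact this
  -- Without a unit, `ζ ∈ D` is not immediate: `ζ - P ζ` is killed by every `1 ⊗ π a`, and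
  -- nondegeneracy makes it zero.
  have hζ : P ζ = ζ := by
    refine (sub_eq_zero.1 ?_).symm
    ext i
    refine hnd _ fun a => ?_
    have h1 : amplify I (π a) (P ζ) = amplify I (π a) ζ := by
      have : P (amplify I (π a) ζ) = amplify I (π a) ζ :=
        Submodule.starProjection_eq_self_iff.2
          ((LinearMap.range L).le_topologicalClosure ⟨a, rfl⟩)
      rw [← this]
      exact (congrArg (fun T => T ζ) (hcomm a)).symm
    have := congrArg (fun f : lp (fun _ : I => H) 2 => f i) h1
    simp only [amplify_apply] at this
    simp [this]
  have : amplify I x ζ ∈ D := by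
    rw [← Submodule.starProjection_eq_self_iff]
    change P _ = _
    rw [hxP, hζ]
  exact this

/-- Real scalars are needed because the map to which this applies, `a ↦ (π a Ω, (π a)* η)`, is only
real linear. -/
theorem mem_closure_range_of_orthogonal {V E : Type*} [AddCommGroup V] [Module ℝ V]
    [NormedAddCommGroup E] [InnerProductSpace ℝ E] [CompleteSpace E] (S : V → E)
    (hadd : ∀ a b, S (a + b) = S a + S b) (hsmul : ∀ (c : ℝ) a, S (c • a) = c • S a) {y : E}
    (h : ∀ w, (∀ a, ⟪S a, w⟫_ℝ = 0) → ⟪w, y⟫_ℝ = 0) : y ∈ closure (Set.range S) := by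
  let L : V →ₗ[ℝ] E := { toFun := S, map_add' := hadd, map_smul' := hsmul }
  have hy : y ∈ (LinearMap.range L)ᗮᗮ := by
    rw [Submodule.mem_orthogonal]
    exact fun w hw => h w fun a => (Submodule.mem_orthogonal _ _).1 hw _ ⟨a, rfl⟩
  rw [Submodule.orthogonal_orthogonal_eq_closure] at hy
  exact hy

/-- Elements of the bicommutant are approximated by elements of the algebra, at one vector, and
with their adjoints at another. -/
theorem exists_norm_sub_lt_of_mem_bicommutant
    (hnd : ∀ ξ, (∀ a, π a ξ = 0) → ξ = 0)
    (hx : x ∈ Set.centralizer (Set.centralizer (Set.range π))) (Ω η : H) {ε : ℝ} (hε : 0 < ε) :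
    ∃ a, ‖π a Ω - x Ω‖ < ε ∧ ‖star (π a) η - star x η‖ < ε := by
  let _ : InnerProductSpace ℝ H := InnerProductSpace.complexToReal
  let S : A → WithLp 2 (H × H) := fun a => WithLp.toLp 2 (π a Ω, star (π a) η)
  have hmem : WithLp.toLp 2 (x Ω, star x η) ∈ closure (Set.range S) := by
    refine mem_closure_range_of_orthogonal S (fun a b => ?_) (fun c a => ?_) fun w hw => ?_
    · simp only [S]
      rw [← WithLp.toLp_add]
      simp
    · simp only [S]
      rw [← WithLp.toLp_smul, ← Complex.coe_smul c a, map_smul, star_smul]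
      simp
    have key : ∀ y : H →L[ℂ] H, ⟪WithLp.toLp 2 (y Ω, star y η), w⟫_ℝ
        = (⟪w.ofLp.1, y Ω⟫_ℂ + ⟪η, y w.ofLp.2⟫_ℂ).re := by
      intro y
      rw [WithLp.prod_inner_apply, real_inner_eq_re_inner ℂ, real_inner_eq_re_inner ℂ,
        ContinuousLinearMap.star_eq_adjoint, ContinuousLinearMap.adjoint_inner_left,
        inner_re_symm]
      simp
    rw [real_inner_comm, key]
    -- In the pairing with `w` the adjoint at `η` becomes the operator itself at `w.2`, so
    -- approximation at the pair `(Ω, w.2)` transfers the orthogonality from `π a` to `x`.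
    let ζ : lp (fun _ : Bool => H) 2 := lp.single 2 true Ω + lp.single 2 false w.ofLp.2
    have hc := amplify_apply_mem_closure (I := Bool) hnd hx ζ
    have h1 : ζ true = Ω := by simp [ζ, lp.single_apply]
    have h2 : ζ false = w.ofLp.2 := by simp [ζ, lp.single_apply]
    have hcl : IsClosed {f : lp (fun _ : Bool => H) 2 |
        (⟪w.ofLp.1, lp.evalCLM ℂ (fun _ : Bool => H) 2 true f⟫_ℂ
          + ⟪η, lp.evalCLM ℂ (fun _ : Bool => H) 2 false f⟫_ℂ).re = 0} :=
      isClosed_eq (by fun_prop) continuous_const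
    have := closure_minimal (s := Set.range fun a => amplify Bool (π a) ζ) ?_ hcl hc
    · have h3 : (⟪w.ofLp.1, amplify Bool x ζ true⟫_ℂ + ⟪η, amplify Bool x ζ false⟫_ℂ).re = 0 := this
      rwa [amplify_apply, amplify_apply, h1, h2] at h3
    · rintro _ ⟨a, rfl⟩
      change (⟪w.ofLp.1, amplify Bool (π a) ζ true⟫_ℂ
        + ⟪η, amplify Bool (π a) ζ false⟫_ℂ).re = 0
      rw [amplify_apply, amplify_apply, h1, h2, ← key]
      exact hw a
  obtain ⟨_, ⟨a, rfl⟩, ha⟩ := Metric.mem_closure_iff.1 hmem ε hε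
  rw [dist_comm, dist_eq_norm] at ha
  refine ⟨a, lt_of_le_of_lt ?_ ha, lt_of_le_of_lt ?_ ha⟩
  · exact WithLp.norm_fst_le (p := 2) (α := H) (β := H) (S a - WithLp.toLp 2 (x Ω, star x η))
  · exact WithLp.norm_snd_le (p := 2) (α := H) (β := H) (S a - WithLp.toLp 2 (x Ω, star x η))

end Density

/-! ### Three lines estimates on the KMS strip -/

section Strip

/-- Boundedness, continuity and holomorphy on the strip between `Im z = 0` and `Im z = β`. -/
structure IsStripFunction (β : ℝ) (F : ℂ → ℂ) : Prop where
  continuousOn : ContinuousOn F {z | min 0 β ≤ z.im ∧ z.im ≤ max 0 β}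
  bounded : ∃ C : ℝ, ∀ z : ℂ, min 0 β ≤ z.im → z.im ≤ max 0 β → ‖F z‖ ≤ C
  differentiableOn : DifferentiableOn ℂ F {z | min 0 β < z.im ∧ z.im < max 0 β}

variable {β : ℝ}

theorem IsStripFunction.sub {F G : ℂ → ℂ} (hF : IsStripFunction β F) (hG : IsStripFunction β G) :
    IsStripFunction β fun z => F z - G z := by
  obtain ⟨C, hC⟩ := hF.bounded
  obtain ⟨D, hD⟩ := hG.bounded
  exact ⟨hF.continuousOn.sub hG.continuousOn,
    ⟨C + D, fun z h1 h2 => (norm_sub_le _ _).trans (add_le_add (hC z h1 h2) (hD z h1 h2))⟩,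
    hF.differentiableOn.sub hG.differentiableOn⟩

theorem mul_mem_strip (β : ℝ) {s : ℝ} (h0 : 0 ≤ s) (h1 : s ≤ 1) :
    min 0 β ≤ β * s ∧ β * s ≤ max 0 β := by
  rcases le_total 0 β with hβ | hβ
  · rw [min_eq_left hβ, max_eq_right hβ]
    exact ⟨by positivity, mul_le_of_le_one_right hβ h1⟩
  · rw [min_eq_right hβ, max_eq_left hβ]
    exact ⟨by nlinarith, by nlinarith⟩

theorem mul_mem_strip_interior (hβ : β ≠ 0) {s : ℝ} (h0 : 0 < s) (h1 : s < 1) :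
    min 0 β < β * s ∧ β * s < max 0 β := by
  rcases hβ.lt_or_gt with hβ | hβ
  · rw [min_eq_right hβ.le, max_eq_left hβ.le]
    exact ⟨by nlinarith, by nlinarith⟩
  · rw [min_eq_left hβ.le, max_eq_right hβ.le]
    exact ⟨by positivity, by nlinarith⟩

/-- The three lines theorem on the strip between `Im z = 0` and `Im z = β`. -/
theorem IsStripFunction.norm_le {F : ℂ → ℂ} (hF : IsStripFunction β F) (hβ : β ≠ 0) {a b : ℝ}
    (ha : ∀ t : ℝ, ‖F t‖ ≤ a) (hb : ∀ t : ℝ, ‖F (t + β * Complex.I)‖ ≤ b) {s : ℝ}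
    (h0 : 0 ≤ s) (h1 : s ≤ 1) : ‖F (β * s * Complex.I)‖ ≤ a ^ (1 - s) * b ^ s := by
  have him : ∀ w : ℂ, (β * w * Complex.I).im = β * w.re := fun w => by simp
  have hc : Continuous fun w : ℂ => (β * w * Complex.I : ℂ) := by fun_prop
  have key := Complex.HadamardThreeLines.norm_le_interp_of_mem_verticalClosedStrip₀₁'
    (fun w => F (β * w * Complex.I)) (z := (s : ℂ)) (a := a) (b := b)
    (by simpa [Complex.HadamardThreeLines.verticalClosedStrip] using ⟨h0, h1⟩) ⟨?_, ?_⟩ ?_ ?_ ?_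
  · simpa using key
  · refine hF.differentiableOn.comp (by fun_prop) fun w hw => ?_
    rw [Set.mem_ofPred_eq, him]
    exact mul_mem_strip_interior hβ hw.1 hw.2
  · refine hF.continuousOn.comp hc.continuousOn fun w hw => ?_
    rw [Set.mem_ofPred_eq, him]
    have hw' : w ∈ Complex.HadamardThreeLines.verticalClosedStrip 0 1 :=
      closure_minimal (Set.preimage_mono (f := Complex.re) Set.Ioo_subset_Icc_self)
        (isClosed_Icc.preimage Complex.continuous_re) hw
    exact mul_mem_strip β hw'.1 hw'.2
  · obtain ⟨C, hC⟩ := hF.bounded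
    refine ⟨C, ?_⟩
    rintro _ ⟨w, hw, rfl⟩
    have := mul_mem_strip β hw.1 hw.2
    exact hC _ (by rw [him]; exact this.1) (by rw [him]; exact this.2)
  · intro w hw
    have : (β * w * Complex.I : ℂ) = ((-(β * w.im) : ℝ) : ℂ) := by
      apply Complex.ext <;> simp_all
    simp only [this]
    exact ha _
  · intro w hw
    have : (β * w * Complex.I : ℂ) = ((-(β * w.im) : ℝ) : ℂ) + β * Complex.I := by
      apply Complex.ext <;> simp_all
    simp only [this]
    exact hb _

/-- If the boundary values form uniform Cauchy sequences on both edges of the strip, and tend to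
zero uniformly on one edge, then they also tend to zero on the other edge. -/
theorem IsStripFunction.norm_apply_zero_le {F : ℕ → ℂ → ℂ} (hF : ∀ n, IsStripFunction β (F n))
    {e : ℕ → ℝ} (he0 : ∀ n, 0 ≤ e n) (he : Tendsto e atTop (𝓝 0)) {B : ℝ}
    (htop : ∀ n t, ‖F n (t : ℝ)‖ ≤ B)
    (hbot : ∀ n (t : ℝ), ‖F n (t + β * Complex.I)‖ ≤ e n)
    (hdiff : ∀ n m (t : ℝ), ‖F n t - F m t‖ ≤ e n + e m) (m : ℕ) : ‖F m 0‖ ≤ e m := by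
  rcases eq_or_ne β 0 with rfl | hβ
  · simpa using hbot m 0
  have hB : 0 ≤ B := (norm_nonneg _).trans (htop 0 0)
  have hint : ∀ s : ℝ, 0 < s → s ≤ 1 → ‖F m (β * s * Complex.I)‖ ≤ e m := by
    intro s hs0 hs1
    -- Write `F m = F n + (F m - F n)`. The first term is at most `B^(1-s) (e n)^s`, which tends to
    -- zero since `s > 0`; the second is bounded by `e m + e n` on both edges, hence inside.
    have hn : ∀ n, ‖F m (β * s * Complex.I)‖ ≤ B ^ (1 - s) * e n ^ s + (e m + e n) := by
      intro n
      have h1 := (hF n).norm_le hβ (htop n) (hbot n) hs0.le hs1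
      have h2 := ((hF m).sub (hF n)).norm_le hβ (hdiff m n) (fun t =>
        (norm_sub_le _ _).trans (add_le_add (hbot m t) (hbot n t))) hs0.le hs1
      rw [← Real.rpow_add_of_nonneg (add_nonneg (he0 m) (he0 n)) (sub_nonneg.2 hs1) hs0.le,
        sub_add_cancel, Real.rpow_one] at h2
      calc _ = ‖F n (β * s * Complex.I)
            + (F m (β * s * Complex.I) - F n (β * s * Complex.I))‖ := by congr 1; ring
        _ ≤ _ := (norm_add_le _ _).trans (add_le_add h1 h2)
    have hlim : Tendsto (fun n => B ^ (1 - s) * e n ^ s + (e m + e n)) atTop (𝓝 (e m)) := by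
      have h1 : Tendsto (fun n => e n ^ s) atTop (𝓝 0) := by
        simpa [Real.zero_rpow hs0.ne'] using he.rpow_const (Or.inr hs0.le)
      simpa using (h1.const_mul (B ^ (1 - s))).add (he.const_add (e m))
    exact ge_of_tendsto' hlim hn
  -- The interior bound does not depend on `s`, so it survives `s → 0`.
  have hcont : Tendsto (fun s : ℝ => F m (β * s * Complex.I)) (𝓝[>] 0) (𝓝 (F m 0)) := by
    have hz : (0 : ℂ) ∈ {z : ℂ | min 0 β ≤ z.im ∧ z.im ≤ max 0 β} := by simp
    refine ((hF m).continuousOn 0 hz).tendsto.comp (tendsto_nhdsWithin_iff.2 ⟨?_, ?_⟩)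
    · have : Continuous fun s : ℝ => (β * s * Complex.I : ℂ) := by fun_prop
      simpa using (this.tendsto 0).mono_left nhdsWithin_le_nhds
    · filter_upwards [Ioc_mem_nhdsGT (zero_lt_one (α := ℝ))] with s hs
      have := mul_mem_strip β hs.1.le hs.2
      simpa using this
  refine le_of_tendsto hcont.norm ?_
  filter_upwards [Ioc_mem_nhdsGT (zero_lt_one (α := ℝ))] with s hs
  exact hint s hs.1 hs.2

end Strip

/-! ### The KMS condition makes the GNS vector separating -/

section Separating

variable {A : Type u} [NonUnitalCStarAlgebra A] [PartialOrder A] [StarOrderedRing A]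
  {φ : A →ₚ[ℂ] ℂ} {H : Type v} [NormedAddCommGroup H] [InnerProductSpace ℂ H] [CompleteSpace H]
  {π : A →⋆ₙₐ[ℂ] (H →L[ℂ] H)} {Ω : H}

/-- The cyclic vector of a KMS state is separating for the bicommutant. -/
theorem IsGNSTriple.isSeparatingFor (h : IsGNSTriple φ π Ω) (hΩ : ‖Ω‖ = 1)
    {α : ℝ → (A ≃⋆ₐ[ℂ] A)} (hα : ∀ a, α 0 a = a) {β : ℝ} (hKMS : IsKMS φ α β) :
    IsSeparatingFor (Set.centralizer (Set.centralizer (Set.range π))) Ω := by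
  intro x hx hxΩ
  have hπn : ∀ a ξ, ‖π a ξ‖ ≤ ‖a‖ * ‖ξ‖ := fun a ξ =>
    ((π a).le_opNorm ξ).trans
      (mul_le_mul_of_nonneg_right (NonUnitalStarAlgHom.norm_apply_le π a) (norm_nonneg _))
  have hαn : ∀ t b, ‖π (α t b) Ω‖ ≤ ‖b‖ := fun t b => by
    simpa [hΩ, StarAlgEquiv.norm_map] using hπn (α t b) Ω
  have hzero : ∀ c b, ⟪star x (star (π c) Ω), π b Ω⟫_ℂ = 0 := by
    intro c b
    set η := star (π c) Ω with hη
    let C : ℝ := ‖b‖ + ‖b‖ * ‖c‖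
    have hC : 0 ≤ C := by positivity
    let ε : ℕ → ℝ := fun n => 1 / (n + 1)
    have hε : ∀ n, 0 < ε n := fun n => Nat.one_div_pos_of_nat
    have hε1 : ∀ n, ε n ≤ 1 := fun n => by
      have : (0 : ℝ) ≤ n := n.cast_nonneg
      exact (div_le_one (by positivity)).2 (by linarith)
    have hεlim : Tendsto ε atTop (𝓝 0) := tendsto_one_div_add_atTop_nhds_zero_nat
    choose a ha1 ha2 using fun n => exists_norm_sub_lt_of_mem_bicommutant
      (fun ξ => nondegenerate_of_cyclic h.cyclic) hx Ω η (hε n)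
    simp only [hxΩ, sub_zero] at ha1
    -- On `Im z = β` the element `a n` stands next to `Ω`, where `π (a n) Ω` is small. On the real
    -- line its adjoint can be moved onto `η`, where it converges. Both estimates are uniform in `t`
    -- because `α t` is isometric.
    choose F hFc hFb hFd hF0 hF1 using fun n => hKMS (c * a n) b
    have htop : ∀ n (t : ℝ), F n t = ⟪star (π (a n)) η, π (α t b) Ω⟫_ℂ := by
      intro n t
      rw [hF0, ← h.inner_eq, hη, ContinuousLinearMap.star_eq_adjoint,
        ContinuousLinearMap.adjoint_inner_left, ContinuousLinearMap.star_eq_adjoint,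
        ContinuousLinearMap.adjoint_inner_left, map_mul, map_mul]
      rfl
    have hbot : ∀ n (t : ℝ), ‖F n (t + β * Complex.I)‖ ≤ C * ε n := by
      intro n t
      rw [hF1, ← h.inner_eq, map_mul, map_mul]
      calc _ ≤ ‖Ω‖ * ‖π (α t b) (π c (π (a n) Ω))‖ := norm_inner_le_norm _ _
        _ ≤ 1 * (‖b‖ * (‖c‖ * ε n)) := by
          rw [hΩ]
          gcongr
          refine (hπn _ _).trans ?_
          rw [StarAlgEquiv.norm_map]
          gcongr
          refine (hπn _ _).trans ?_
          gcongr
          exact (ha1 n).le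
        _ ≤ C * ε n := by
          have := mul_nonneg (norm_nonneg b) (hε n).le
          simp only [C]
          linarith
    have hdiff : ∀ n m (t : ℝ), ‖F n t - F m t‖ ≤ C * ε n + C * ε m := by
      intro n m t
      rw [htop, htop, ← inner_sub_left]
      refine (norm_inner_le_norm _ _).trans ?_
      have h1 : ‖star (π (a n)) η - star (π (a m)) η‖ ≤ ε n + ε m := by
        refine (norm_sub_le_norm_sub_add_norm_sub _ (star x η) _).trans ?_
        rw [norm_sub_rev (star x η)]
        exact add_le_add (ha2 n).le (ha2 m).le
      calc _ ≤ (ε n + ε m) * C := by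
            gcongr
            exact (hαn t b).trans (le_add_of_nonneg_right (by positivity))
        _ = _ := by ring
    have hbd : ∀ n (t : ℝ), ‖F n t‖ ≤ (‖star x η‖ + 1) * ‖b‖ := by
      intro n t
      rw [htop]
      refine (norm_inner_le_norm _ _).trans ?_
      gcongr
      · have := norm_le_norm_add_norm_sub (star x η) (star (π (a n)) η)
        rw [norm_sub_rev] at this
        linarith [ha2 n, hε1 n]
      · exact hαn t b
    have hlim0 : Tendsto (fun n => F n 0) atTop (𝓝 0) := by
      refine squeeze_zero_norm (IsStripFunction.norm_apply_zero_le
        (fun n => ⟨hFc n, hFb n, hFd n⟩) (fun n => mul_nonneg hC (hε n).le) ?_ hbd hbot hdiff) ?_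
      all_goals simpa using hεlim.const_mul C
    have hlim1 : Tendsto (fun n => F n 0) atTop (𝓝 ⟪star x η, π b Ω⟫_ℂ) := by
      have h1 : Tendsto (fun n => star (π (a n)) η) atTop (𝓝 (star x η)) :=
        tendsto_iff_norm_sub_tendsto_zero.2
          (squeeze_zero (fun _ => norm_nonneg _) (fun n => (ha2 n).le) hεlim)
      have h2 : ∀ n, F n 0 = ⟪star (π (a n)) η, π b Ω⟫_ℂ := fun n => by
        simpa [hα] using htop n 0
      simp only [h2]
      exact h1.inner tendsto_const_nhds
    exact tendsto_nhds_unique hlim1 hlim0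
  have hx1 : ∀ b, x (π b Ω) = 0 := by
    intro b
    refine h.cyclic.eq_zero_of_inner_right ℂ ?_
    rintro _ ⟨c, rfl⟩
    have := hzero (star c) b
    rwa [map_star, star_star, ContinuousLinearMap.star_eq_adjoint,
      ContinuousLinearMap.adjoint_inner_left] at this
  have := Continuous.ext_on h.cyclic x.continuous (0 : H →L[ℂ] H).continuous
    (by rintro _ ⟨b, rfl⟩; simpa using hx1 b)
  exact DFunLike.coe_injective this

end Separating

/-! ### Vectors from the commutant -/

section CommutantVectors

variable {A : Type*} [NonUnitalCStarAlgebra A]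
  {H : Type*} [NormedAddCommGroup H] [InnerProductSpace ℂ H] [CompleteSpace H]
  {π : A →⋆ₙₐ[ℂ] (H →L[ℂ] H)} {Ω : H}

theorem mem_centralizer_range_iff {y : H →L[ℂ] H} :
    y ∈ StarSubalgebra.centralizer ℂ (Set.range π) ↔ ∀ a, π a * y = y * π a := by
  rw [StarSubalgebra.mem_centralizer_iff]
  constructor
  · exact fun h a => (h _ ⟨a, rfl⟩).1
  · rintro h _ ⟨a, rfl⟩
    exact ⟨h a, by rw [← map_star]; exact h _⟩

theorem mem_centralizer_range_iff' {y : H →L[ℂ] H} :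
    y ∈ StarSubalgebra.centralizer ℂ (Set.range π) ↔ y ∈ Set.centralizer (Set.range π) := by
  rw [mem_centralizer_range_iff, Set.mem_centralizer_iff]
  exact ⟨by rintro h _ ⟨a, rfl⟩; exact h a, fun h a => h _ ⟨a, rfl⟩⟩

/-- A vector separating for the bicommutant is cyclic for the commutant. -/
theorem IsSeparatingFor.dense_centralizer
    (h : IsSeparatingFor (Set.centralizer (Set.centralizer (Set.range π))) Ω) :
    Dense ((fun y : H →L[ℂ] H => y Ω) '' StarSubalgebra.centralizer ℂ (Set.range π)) := by
  set S := StarSubalgebra.centralizer ℂ (Set.range π) with hS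
  let E := Submodule.map (ContinuousLinearMap.apply ℂ H Ω).toLinearMap
    (Subalgebra.toSubmodule S.toSubalgebra)
  have hE : (E : Set H) = (fun y : H →L[ℂ] H => y Ω) '' S := rfl
  rw [← hE]
  let D := E.topologicalClosure
  have hD : IsClosed (D : Set H) := E.isClosed_topologicalClosure
  have : CompleteSpace D := hD.completeSpace_coe
  let P := D.starProjection
  have hinv : ∀ y ∈ S, ∀ ξ ∈ D, y ξ ∈ D := by
    intro y hy ξ hξ
    refine E.topologicalClosure_minimal (t := D.comap y.toLinearMap) ?_
      (hD.preimage y.continuous) hξ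
    rintro _ ⟨z, hz, rfl⟩
    exact E.le_topologicalClosure ⟨y * z, S.mul_mem hy hz, rfl⟩
  have h1 : ∀ y ∈ S, P * (y * P) = y * P := fun y hy => by
    ext1 ξ
    exact Submodule.starProjection_eq_self_iff.2 (hinv y hy _ (D.starProjection_apply_mem ξ))
  -- The projection `P` onto the closure of `π(A)' Ω` commutes with `π(A)'`. Hence `1 - P` is in the
  -- bicommutant and kills `Ω`.
  have hP : 1 - P ∈ Set.centralizer (Set.centralizer (Set.range π)) := by
    intro y hy
    rw [← mem_centralizer_range_iff', ← hS] at hy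
    have h2 := congrArg star (h1 (star y) (star_mem hy))
    have hP : star P = P := isSelfAdjoint_starProjection D
    rw [star_mul, star_mul, star_star, hP] at h2
    rw [mul_assoc, h1 y hy] at h2
    rw [mul_sub, sub_mul, mul_one, one_mul, h2]
  have hΩ : P Ω = Ω :=
    Submodule.starProjection_eq_self_iff.2 (E.le_topologicalClosure ⟨1, S.one_mem, rfl⟩)
  have h3 := h _ hP (by simp [hΩ])
  intro ξ
  have h4 : P ξ = ξ := by rw [← sub_eq_zero.1 h3]; rfl
  exact Submodule.starProjection_eq_self_iff.1 h4

/-- A partition of unity in the commutant expresses a vector state of the algebra by a total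
sequence of vectors. -/
theorem IsSeparatingFor.exists_total_sequence [TopologicalSpace.SeparableSpace H]
    (h : IsSeparatingFor (Set.centralizer (Set.centralizer (Set.range π))) Ω) (hΩ : ‖Ω‖ = 1) :
    ∃ ζ : ℕ → H, (∀ ξ, (∀ k, ⟪ζ k, ξ⟫_ℂ = 0) → ξ = 0) ∧ HasSum (fun k => ‖ζ k‖ ^ 2) 1 ∧
      ∀ a, HasSum (fun k => ⟪ζ k, π a (ζ k)⟫_ℂ) ⟪Ω, π a Ω⟫_ℂ := by
  set S := StarSubalgebra.centralizer ℂ (Set.range π) with hS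
  let R : Set H := (fun y : H →L[ℂ] H => y Ω) '' S
  have hR : Dense R := h.dense_centralizer
  have : Nonempty R := ⟨⟨_, 1, S.one_mem, rfl⟩⟩
  have : TopologicalSpace.SeparableSpace R :=
    (TopologicalSpace.IsSeparable.of_separableSpace R).separableSpace
  obtain ⟨u, hu⟩ := TopologicalSpace.exists_dense_seq R
  have hdense : DenseRange fun k => (u k : H) :=
    DenseRange.comp (g := ((↑) : R → H)) (by simpa [DenseRange] using hR) hu continuous_subtype_val
  choose z hzS hzu using fun k => (u k).2
  -- Scaling to `‖y k‖ ≤ 2^(-k-1)` gives `∑ ‖y k‖² ≤ 1/3`, which leaves room for the square root `r`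
  -- of `1 - T` to complete `∑ Y k* Y k = 1`.
  let c : ℕ → ℝ := fun k => (1 / 2) ^ (k + 1) / (1 + ‖z k‖)
  have hc : ∀ k, 0 < c k := fun k => by positivity
  let y : ℕ → H →L[ℂ] H := fun k => (c k : ℂ) • z k
  have hyS : ∀ k, y k ∈ S := fun k => S.smul_mem (hzS k) _
  have hyn : ∀ k, ‖y k‖ ≤ (1 / 2) ^ (k + 1) := by
    intro k
    rw [norm_smul, Complex.norm_real, Real.norm_of_nonneg (hc k).le, div_mul_eq_mul_div,
      div_le_iff₀ (by positivity)]
    exact mul_le_mul_of_nonneg_left (by linarith) (by positivity)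
  have hTn : ∀ k, ‖star (y k) * y k‖ ≤ 1 / 4 * (1 / 4) ^ k := by
    intro k
    rw [CStarRing.norm_star_mul_self]
    calc _ ≤ (1 / 2 : ℝ) ^ (k + 1) * (1 / 2) ^ (k + 1) :=
          mul_le_mul (hyn k) (hyn k) (norm_nonneg _) (by positivity)
      _ = _ := by rw [← mul_pow, pow_succ]; ring
  have hgeo : HasSum (fun k : ℕ => (1 / 4 : ℝ) * (1 / 4) ^ k) (1 / 3) := by
    have := (hasSum_geometric_of_lt_one (r := (1 / 4 : ℝ)) (by norm_num) (by norm_num)).mul_left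
      (1 / 4)
    norm_num at this ⊢
    exact this
  have hsumm : Summable fun k => star (y k) * y k := hgeo.summable.of_norm_bounded hTn
  obtain ⟨T, hT⟩ := hsumm
  have hTnorm : ‖T‖ ≤ 1 := by
    rw [← hT.tsum_eq]
    exact (tsum_of_norm_bounded hgeo hTn).trans (by norm_num)
  have hTsa : IsSelfAdjoint T := by
    have := hT.star
    simp only [star_mul, star_star] at this
    exact this.unique hT
  have hT1 : 0 ≤ 1 - T := sub_nonneg.2 (hTsa.le_one_of_norm_le hTnorm)
  have hTS : T ∈ S := by
    rw [mem_centralizer_range_iff]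
    intro a
    refine (hT.mul_left (π a)).unique ?_
    convert hT.mul_right (π a) using 1
    funext k
    exact mem_centralizer_range_iff.1 (mul_mem (star_mem (hyS k)) (hyS k)) a
  let r := CFC.sqrt (1 - T)
  have hr0 : 0 ≤ r := CFC.sqrt_nonneg _
  have hrr : star r * r = 1 - T := by
    rw [hr0.isSelfAdjoint.star_eq]
    exact CFC.sqrt_mul_sqrt_self _ hT1
  have hrS : r ∈ S := by
    rw [mem_centralizer_range_iff]
    intro a
    have h1 : Commute (1 - T) (π a) :=
      (mem_centralizer_range_iff.1 (S.sub_mem S.one_mem hTS) a).symm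
    have h2 : r = cfc Real.sqrt (1 - T) := by
      rw [← cfcₙ_eq_cfc, ← CFC.sqrt_eq_real_sqrt _ hT1]
    rw [h2]
    exact (h1.cfc_real Real.sqrt).symm
  let Y : ℕ → H →L[ℂ] H := fun k => Nat.casesOn k r y
  have hYS : ∀ k, Y k ∈ S := fun k => by
    cases k with
    | zero => exact hrS
    | succ k => exact hyS k
  have hY : HasSum (fun k => star (Y k) * Y k) 1 := by
    have h1 := HasSum.zero_add (f := fun k => star (Y k) * Y k) hT
    have h2 : star (Y 0) * Y 0 = 1 - T := hrr
    rwa [h2, sub_add_cancel] at h1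
  -- Commutation gives `⟨Y k Ω, X Y k Ω⟩ = ⟨Ω, Y k* Y k X Ω⟩`, and the `Y k* Y k` sum to `1`.
  have hsum : ∀ X : H →L[ℂ] H, (∀ k, X * Y k = Y k * X) →
      HasSum (fun k => ⟪Y k Ω, X (Y k Ω)⟫_ℂ) ⟪Ω, X Ω⟫_ℂ := by
    intro X hX
    have h1 := ((innerSL ℂ Ω) ∘L ContinuousLinearMap.apply ℂ H (X Ω)).hasSum hY
    refine h1.congr_fun fun k => ?_
    have h2 : X (Y k Ω) = Y k (X Ω) := congrArg (fun T => T Ω) (hX k)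
    change _ = ⟪Ω, star (Y k) (Y k (X Ω))⟫_ℂ
    rw [h2, ContinuousLinearMap.star_eq_adjoint, ContinuousLinearMap.adjoint_inner_right]
  refine ⟨fun k => Y k Ω, fun ξ hξ => ?_, ?_, fun a => hsum _ fun k =>
    mem_centralizer_range_iff.1 (hYS k) a⟩
  · refine Dense.eq_zero_of_inner_right ℂ hdense ?_
    rintro _ ⟨k, rfl⟩
    have h1 : ⟪y k Ω, ξ⟫_ℂ = 0 := hξ (k + 1)
    have h2 : y k Ω = (c k : ℂ) • (u k : H) := by rw [← hzu k]; rfl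
    rw [h2, inner_smul_left, mul_eq_zero] at h1
    exact h1.resolve_left (by simpa using (hc k).ne')
  · have h1 := hsum 1 fun k => by rw [one_mul, mul_one]
    have h2 := (Complex.reCLM).hasSum h1
    convert h2 using 1
    · funext k
      simp [← inner_self_eq_norm_sq (𝕜 := ℂ)]
    · simp [hΩ]

end CommutantVectors

/-! ### Diagonalizing a density operator -/

section Diagonalization

variable {H : Type u} [NormedAddCommGroup H] [InnerProductSpace ℂ H] [CompleteSpace H]

/-- Orthonormal vectors are `√2` apart, so the balls of radius `1/2` around them are disjoint open
sets. -/
theorem Orthonormal.countable [TopologicalSpace.SeparableSpace H] {ι : Type*} {v : ι → H}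
    (hv : Orthonormal ℂ v) : Countable ι := by
  rw [← Set.countable_univ_iff]
  refine Set.PairwiseDisjoint.countable_of_isOpen (s := fun i => Metric.ball (v i) (1 / 2)) ?_
    (fun _ _ => Metric.isOpen_ball) fun i _ => ⟨v i, Metric.mem_ball_self (by norm_num)⟩
  intro i _ j _ hij
  refine Metric.ball_disjoint_ball ?_
  have h : ‖v i - v j‖ ^ 2 = 2 := by
    rw [norm_sub_sq (𝕜 := ℂ), hv.1 i, hv.1 j, hv.2 hij]
    norm_num
  rw [dist_eq_norm]
  nlinarith [norm_nonneg (v i - v j)]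

/-- The spectral theorem for compact self-adjoint operators, with a Hilbert basis. -/
theorem exists_hilbertBasis_eigenvectors {T : H →L[ℂ] H}
    (hc : IsCompactOperator T) (hs : T.toLinearMap.IsSymmetric) :
    ∃ (κ : Type u) (b : HilbertBasis κ ℂ H) (μ : κ → ℂ), ∀ k, T (b k) = μ k • b k := by
  have hcl : ∀ μ : ℂ, IsClosed (Module.End.eigenspace T.toLinearMap μ : Set H) := fun μ => by
    have : (Module.End.eigenspace T.toLinearMap μ : Set H) = {ξ | T ξ = μ • ξ} := by
      ext ξ
      simp
    rw [this]
    exact isClosed_eq T.continuous (continuous_const_smul μ)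
  have hcomp : ∀ μ : ℂ, CompleteSpace (Module.End.eigenspace T.toLinearMap μ) :=
    fun μ => (hcl μ).completeSpace_coe
  choose w b hb using fun μ => exists_hilbertBasis ℂ (Module.End.eigenspace T.toLinearMap μ)
  let v : (Σ μ, w μ) → H := fun a => (b a.1 a.2 : H)
  have horth : Orthonormal ℂ v := hs.orthogonalFamily_eigenspaces.orthonormal_sigma_orthonormal
    (fun μ => (b μ).orthonormal)
  have hbot : (Submodule.span ℂ (Set.range v))ᗮ = ⊥ := by
    rw [eq_bot_iff, ← ContinuousLinearMap.orthogonalComplement_iSup_eigenspaces_eq_bot hc hs]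
    intro ξ hξ
    rw [Submodule.mem_orthogonal] at hξ
    rw [← Submodule.iInf_orthogonal, Submodule.mem_iInf]
    intro μ
    rw [Submodule.mem_orthogonal']
    intro η hη
    let p := (Module.End.eigenspace T.toLinearMap μ).orthogonalProjectionOnto ξ
    have hp : p = 0 := by
      refine (b μ).repr.injective ?_
      ext i
      rw [(b μ).repr_apply_apply, Submodule.inner_orthogonalProjectionOnto_eq_of_mem_left,
        hξ _ (Submodule.subset_span ⟨⟨μ, i⟩, rfl⟩)]
      simp
    have h2 : ⟪p, (⟨η, hη⟩ : Module.End.eigenspace T.toLinearMap μ)⟫_ℂ = ⟪ξ, η⟫_ℂ :=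
      Submodule.inner_orthogonalProjectionOnto_eq_of_mem_right _ _
    rw [← h2, hp, inner_zero_left]
  refine ⟨_, HilbertBasis.mkOfOrthogonalEqBot horth hbot, fun a => a.1, fun a => ?_⟩
  rw [HilbertBasis.coe_mkOfOrthogonalEqBot]
  exact Module.End.mem_eigenspace_iff.1 (b a.1 a.2).2

/-- The density operator of a square summable sequence of vectors. -/
theorem exists_density_operator {ζ : ℕ → H} (hζ : Summable fun k => ‖ζ k‖ ^ 2) :
    ∃ T : H →L[ℂ] H, IsCompactOperator T ∧ T.toLinearMap.IsSymmetric ∧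
      ∀ ξ, HasSum (fun k => ⟪ζ k, ξ⟫_ℂ • ζ k) (T ξ) := by
  have hsumm : Summable fun k => InnerProductSpace.rankOne ℂ (ζ k) (ζ k) :=
    hζ.of_norm_bounded fun k => by rw [InnerProductSpace.norm_rankOne, sq]
  obtain ⟨T, hT⟩ := hsumm
  have hTapp : ∀ ξ, HasSum (fun k => ⟪ζ k, ξ⟫_ℂ • ζ k) (T ξ) := fun ξ => by
    have := (ContinuousLinearMap.apply ℂ H ξ).hasSum hT
    simpa only [ContinuousLinearMap.apply_apply, InnerProductSpace.rankOne_apply] using this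
  have hTin : ∀ ξ η, HasSum (fun k => ⟪ζ k, ξ⟫_ℂ * ⟪η, ζ k⟫_ℂ) ⟪η, T ξ⟫_ℂ := fun ξ η => by
    have := (innerSL ℂ η).hasSum (hTapp ξ)
    simpa only [innerSL_apply_apply, inner_smul_right] using this
  refine ⟨T, ?_, ?_, hTapp⟩
  · refine isClosed_setOfPred_isCompactOperator.mem_of_tendsto hT (Eventually.of_forall fun s => ?_)
    induction s using Finset.cons_induction with
    | empty => exact isCompactOperator_zero
    | cons k s hk ih =>
      rw [Finset.sum_cons]
      refine IsCompactOperator.add ?_ ih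
      rw [InnerProductSpace.rankOne_def']
      have h1 : IsCompactOperator (ContinuousLinearMap.toSpanSingleton ℂ (ζ k)) :=
        isCompactOperator_of_locallyCompactSpace_rng _
      exact h1.comp_clm (innerSL ℂ (ζ k))
  · intro ξ η
    change ⟪T ξ, η⟫_ℂ = ⟪ξ, T η⟫_ℂ
    rw [← inner_conj_symm]
    refine HasSum.unique ?_ (hTin η ξ)
    refine ((Complex.conjCLE : ℂ →L[ℝ] ℂ).hasSum (hTin ξ η)).congr_fun fun k => ?_
    simp [mul_comm]

theorem HilbertBasis.hasSum_norm_inner_sq {κ : Type*} (b : HilbertBasis κ ℂ H) (ξ : H) :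
    HasSum (fun i => ‖⟪b i, ξ⟫_ℂ‖ ^ 2) (‖ξ‖ ^ 2) := by
  have h1 := Complex.reCLM.hasSum (b.hasSum_inner_mul_inner ξ ξ)
  have h2 : Complex.reCLM ⟪ξ, ξ⟫_ℂ = ‖ξ‖ ^ 2 := inner_self_eq_norm_sq (𝕜 := ℂ) ξ
  rw [h2] at h1
  refine h1.congr_fun fun i => ?_
  rw [Complex.reCLM_apply, ← inner_conj_symm ξ, mul_comm, Complex.mul_conj,
    Complex.normSq_eq_norm_sq, Complex.ofReal_re]

/-- The trace of a density operator against `x` can be evaluated in a basis of eigenvectors. -/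
theorem HilbertBasis.hasSum_eigenvalue_mul_inner {κ : Type*} (b : HilbertBasis κ ℂ H) {w : κ → ℝ}
    {T : H →L[ℂ] H} (hw : ∀ i, T (b i) = (w i : ℂ) • b i) {ζ : ℕ → H}
    (hζ : Summable fun k => ‖ζ k‖ ^ 2) (hT : ∀ ξ, HasSum (fun k => ⟪ζ k, ξ⟫_ℂ • ζ k) (T ξ))
    (x : H →L[ℂ] H) :
    HasSum (fun i => (w i : ℂ) * ⟪b i, x (b i)⟫_ℂ) (∑' k, ⟪ζ k, x (ζ k)⟫_ℂ) := by
  have hbound : ∀ y : H →L[ℂ] H, Summable fun p : ℕ × κ => ‖⟪b p.2, y (ζ p.1)⟫_ℂ‖ ^ 2 := by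
    intro y
    rw [summable_prod_of_nonneg fun p => by positivity]
    refine ⟨fun k => (b.hasSum_norm_inner_sq (y (ζ k))).summable, ?_⟩
    simp only [(b.hasSum_norm_inner_sq _).tsum_eq]
    refine (hζ.mul_left (‖y‖ ^ 2)).of_nonneg_of_le (fun k => by positivity) fun k => ?_
    rw [← mul_pow]
    have := y.le_opNorm (ζ k)
    gcongr
  -- Absolute summability of the double series permits both orders of summation: over the basis
  -- first gives `∑ ⟨ζ k, x ζ k⟩`, over `k` first gives `w i ⟨b i, x b i⟩`.
  have hdouble : Summable fun p : ℕ × κ => ⟪ζ p.1, b p.2⟫_ℂ * ⟪b p.2, x (ζ p.1)⟫_ℂ := by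
    refine ((hbound 1).add (hbound x)).of_norm_bounded fun p => ?_
    rw [norm_mul, norm_inner_symm, one_apply_eq_self]
    nlinarith [sq_nonneg (‖⟪b p.2, ζ p.1⟫_ℂ‖ - ‖⟪b p.2, x (ζ p.1)⟫_ℂ‖),
      sq_nonneg ‖⟪b p.2, ζ p.1⟫_ℂ‖, sq_nonneg ‖⟪b p.2, x (ζ p.1)⟫_ℂ‖]
  have h1 := hdouble.hasSum.prod_fiberwise fun k => b.hasSum_inner_mul_inner (ζ k) (x (ζ k))
  rw [h1.tsum_eq]
  have h2 : HasSum (fun p : κ × ℕ => ⟪ζ p.2, b p.1⟫_ℂ * ⟪b p.1, x (ζ p.2)⟫_ℂ)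
      (∑' p : ℕ × κ, ⟪ζ p.1, b p.2⟫_ℂ * ⟪b p.2, x (ζ p.1)⟫_ℂ) :=
    (Equiv.prodComm κ ℕ).hasSum_iff.2 hdouble.hasSum
  refine h2.prod_fiberwise fun i => ?_
  have h3 := (innerSL ℂ (b i) ∘L x).hasSum (hT (b i))
  have h4 : (innerSL ℂ (b i) ∘L x) (T (b i)) = (w i : ℂ) * ⟪b i, x (b i)⟫_ℂ := by
    rw [hw]
    simp
  rw [h4] at h3
  refine h3.congr_fun fun k => ?_
  simp

/-- A total square summable sequence of vectors defines the same normal functional as a Hilbert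
basis with positive weights. -/
theorem exists_diagonalization [TopologicalSpace.SeparableSpace H] {ζ : ℕ → H}
    (htot : ∀ ξ, (∀ k, ⟪ζ k, ξ⟫_ℂ = 0) → ξ = 0) (hζ : HasSum (fun k => ‖ζ k‖ ^ 2) 1) :
    ∃ (κ : Type u) (_ : Countable κ) (b : HilbertBasis κ ℂ H) (w : κ → ℝ),
      (∀ i, 0 < w i) ∧ HasSum w 1 ∧ ∀ x : H →L[ℂ] H,
        HasSum (fun i => (w i : ℂ) * ⟪b i, x (b i)⟫_ℂ) (∑' k, ⟪ζ k, x (ζ k)⟫_ℂ) := by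
  obtain ⟨T, hc, hs, hT⟩ := exists_density_operator hζ.summable
  obtain ⟨κ, b, μ, hμ⟩ := exists_hilbertBasis_eigenvectors hc hs
  have hbn : ∀ i, ‖b i‖ = 1 := b.orthonormal.1
  have hw : ∀ i, ∃ w : ℝ, HasSum (fun k => ‖⟪ζ k, b i⟫_ℂ‖ ^ 2) w ∧ T (b i) = (w : ℂ) • b i := by
    intro i
    have hws : Summable fun k => ‖⟪ζ k, b i⟫_ℂ‖ ^ 2 :=
      hζ.summable.of_nonneg_of_le (fun k => by positivity) fun k => by
        have := norm_inner_le_norm (𝕜 := ℂ) (ζ k) (b i)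
        rw [hbn, mul_one] at this
        gcongr
    obtain ⟨w, hw⟩ := hws
    refine ⟨w, hw, ?_⟩
    have h1 : ⟪b i, T (b i)⟫_ℂ = μ i := by
      rw [hμ, inner_smul_right, inner_self_eq_norm_sq_to_K, hbn]
      simp
    rw [hμ, ← h1]
    congr 1
    refine ((innerSL ℂ (b i)).hasSum (hT (b i))).unique
      ((Complex.hasSum_ofReal.2 hw).congr_fun fun k => ?_)
    rw [innerSL_apply_apply, inner_smul_right, ← inner_conj_symm (b i), Complex.mul_conj,
      Complex.normSq_eq_norm_sq]
  choose w hws hwT using hw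
  -- As `w i = ∑ |⟨ζ k, b i⟩|²`, a zero eigenvalue would make `b i` orthogonal to a total sequence.
  have hw0 : ∀ i, 0 < w i := by
    intro i
    refine ((hws i).nonneg fun k => by positivity).lt_of_ne' fun h0 => ?_
    have h1 := hws i
    rw [h0, hasSum_zero_iff_of_nonneg fun k => by positivity] at h1
    have h2 := htot (b i) fun k => by simpa using congrFun h1 k
    have := hbn i
    rw [h2, norm_zero] at this
    exact zero_ne_one this
  have hdiag := b.hasSum_eigenvalue_mul_inner hwT hζ.summable hT
  refine ⟨κ, b.orthonormal.countable, b, w, hw0, ?_, hdiag⟩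
  have h1 := Complex.reCLM.hasSum (hdiag 1)
  have h2 : HasSum (fun k => ⟪ζ k, (1 : H →L[ℂ] H) (ζ k)⟫_ℂ) ((1 : ℝ) : ℂ) := by
    refine (Complex.hasSum_ofReal.2 hζ).congr_fun fun k => ?_
    simp [inner_self_eq_norm_sq_to_K]
  rw [h2.tsum_eq] at h1
  simpa [inner_self_eq_norm_sq_to_K, hbn, Function.comp_def] using h1

end Diagonalization

/-! ### The faithful normal state of a total sequence -/

section NormalState

variable {H : Type u} [NormedAddCommGroup H] [InnerProductSpace ℂ H] [CompleteSpace H]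

/-- A total sequence of vectors, square summable with sum `1`, defines a faithful normal state. -/
theorem exists_faithful_normal_state {ζ : ℕ → H}
    (htot : ∀ ξ, (∀ k, ⟪ζ k, ξ⟫_ℂ = 0) → ξ = 0) (hζ : HasSum (fun k => ‖ζ k‖ ^ 2) 1) :
    ∃ σ : (H →L[ℂ] H) →ₚ[ℂ] ℂ, IsState σ ∧ IsFaithful σ ∧ IsNormalOnBH σ ∧
      ∀ x, σ x = ∑' k, ⟪ζ k, x (ζ k)⟫_ℂ := by
  have hbound : ∀ (x : H →L[ℂ] H) k, ‖⟪ζ k, x (ζ k)⟫_ℂ‖ ≤ ‖x‖ * ‖ζ k‖ ^ 2 := fun x k =>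
    calc _ ≤ ‖ζ k‖ * (‖x‖ * ‖ζ k‖) := (norm_inner_le_norm _ _).trans
          (mul_le_mul_of_nonneg_left (x.le_opNorm _) (norm_nonneg _))
      _ = _ := by ring
  have hsum : ∀ x : H →L[ℂ] H, Summable fun k => ⟪ζ k, x (ζ k)⟫_ℂ := fun x =>
    (hζ.summable.mul_left ‖x‖).of_norm_bounded (hbound x)
  let f : (H →L[ℂ] H) →ₗ[ℂ] ℂ :=
    { toFun := fun x => ∑' k, ⟪ζ k, x (ζ k)⟫_ℂ
      map_add' := fun x y => by
        rw [← (hsum x).tsum_add (hsum y)]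
        simp
      map_smul' := fun c x => by
        simp [tsum_mul_left] }
  let σ : (H →L[ℂ] H) →ₚ[ℂ] ℂ := PositiveLinearMap.mk₀ f fun x hx =>
    tsum_nonneg fun k => nonneg_iff_forall_inner.1 hx (ζ k)
  have hσ : ∀ x, σ x = ∑' k, ⟪ζ k, x (ζ k)⟫_ℂ := fun x => rfl
  have hσ1 : σ 1 = 1 := by
    rw [hσ]
    have h : HasSum (fun k => ⟪ζ k, (1 : H →L[ℂ] H) (ζ k)⟫_ℂ) ((1 : ℝ) : ℂ) := by
      refine (Complex.hasSum_ofReal.2 hζ).congr_fun fun k => ?_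
      simp [inner_self_eq_norm_sq_to_K]
    rw [h.tsum_eq, Complex.ofReal_one]
  have hσn : ∀ x, ‖σ x‖ ≤ ‖x‖ := fun x => by
    have := tsum_of_norm_bounded (hζ.mul_left ‖x‖) (hbound x)
    rwa [mul_one] at this
  refine ⟨σ, ⟨?_, ?_⟩, ?_, ?_, hσ⟩
  · rintro _ ⟨x, hx, rfl⟩
    exact (hσn x).trans (mem_closedBall_zero_iff.1 hx)
  · intro c hc
    have h1 : ‖(1 : H →L[ℂ] H)‖ ≤ 1 := ContinuousLinearMap.norm_id_le
    simpa [hσ1] using hc ⟨1, mem_closedBall_zero_iff.2 h1, rfl⟩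
  · intro x hx
    have h1 : ∀ k, ⟪ζ k, (star x * x) (ζ k)⟫_ℂ = ((‖x (ζ k)‖ ^ 2 : ℝ) : ℂ) := fun k => by
      change ⟪ζ k, star x (x (ζ k))⟫_ℂ = _
      rw [ContinuousLinearMap.star_eq_adjoint, ContinuousLinearMap.adjoint_inner_right,
        inner_self_eq_norm_sq_to_K]
      norm_cast
    have h2 := (hsum (star x * x)).hasSum
    rw [← hσ, hx] at h2
    simp only [h1] at h2
    have h3 : HasSum (fun k => ‖x (ζ k)‖ ^ 2) 0 := by
      rw [← Complex.ofReal_zero] at h2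
      exact Complex.hasSum_ofReal.1 h2
    rw [hasSum_zero_iff_of_nonneg fun k => by positivity] at h3
    -- From `σ (x* x) = ∑ ‖x ζ k‖² = 0` each `x ζ k` vanishes. Every `x* η` is then orthogonal to
    -- all `ζ k`, which is where totality enters.
    rw [← star_eq_zero]
    ext1 η
    refine htot _ fun k => ?_
    have h4 : x (ζ k) = 0 := by simpa using congrFun h3 k
    rw [ContinuousLinearMap.star_eq_adjoint, ContinuousLinearMap.adjoint_inner_right, h4,
      inner_zero_left]
  · exact continuous_iInf_dom (i := ζ) (continuous_iInf_dom (i := ζ) (continuous_iInf_dom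
      (i := hζ.summable) (continuous_iInf_dom (i := hζ.summable) continuous_induced_dom)))

end NormalState

/-! ### Conclusion -/

theorem corollary3p5 {A : Type u} [NonUnitalCStarAlgebra A] [PartialOrder A] [StarOrderedRing A]
    (φ : A →ₚ[ℂ] ℂ) (hφ : IsState φ) (hfaithful : IsFaithful φ)
    (hsep : TopologicalSpace.SeparableSpace φ.GNS)
    (α : ℝ → (A ≃⋆ₐ[ℂ] A)) (hα : IsOneParameterGroup α)
    (β : ℝ) (hKMS : IsKMS φ α β) :
    GNSVectorSeparating φ ∧ IsPullbackOfFaithfulNormalState φ ∧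
      EmbedsInTypeIIIFactors.{u, v} φ := by
  obtain ⟨Ω, hGNS, hΩ⟩ := hφ.exists_isGNSTriple
  have hS := hGNS.isSeparatingFor hΩ hα.map_zero hKMS
  obtain ⟨ζ, htot, hζ, hφζ⟩ := hS.exists_total_sequence hΩ
  have hφζ : ∀ a, ∑' k, ⟪ζ k, φ.gnsNonUnitalStarAlgHom a (ζ k)⟫_ℂ = φ a := fun a => by
    rw [(hφζ a).tsum_eq, hGNS.inner_eq]
  refine ⟨⟨hsep, Ω, hGNS, hS⟩, ?_, ?_⟩
  · obtain ⟨σ, h1, h2, h3, h4⟩ := exists_faithful_normal_state htot hζ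
    exact ⟨φ.GNS, inferInstance, inferInstance, inferInstance, hsep, φ.gnsNonUnitalStarAlgHom, σ,
      h1, h2, h3, fun a => by rw [h4, hφζ]⟩
  · obtain ⟨κ, hκ, b, w, hw0, hw1, hw⟩ := exists_diagonalization htot hζ
    exact embedsInTypeIIIFactors_of_diagonal hfaithful φ.gnsNonUnitalStarAlgHom b hw0 hw1
      fun a => by rw [← hφζ a]; exact hw _
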